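/- Let $d\ge 1$, let $Q=\mathbb{R}^{d-1}/\mathbb{Z}^{d-1}$ be the $(d-1)$-dimensional flat torus and $S=Q\times\mathbb{R}$ the strip, with points $x=(x',z)$ and gradient $\nabla=(\nabla',\partial_z)$. Let $G(u)=\frac{(1-u^2)^2}{4}$ and, for $c\in\mathbb{R}$, let $v_c(z)=\tanh\!\left(\frac{z-c}{\sqrt2}\right)$ and $v_{cz}=\partial_z v_c$. There is a universal constant $C\in(0,\infty)$, independent of $d$, $c$ and $f$, such that for every $c\in\mathbb{R}$ and every real-valued $f\in H^3(S)$ with $\int_S f\,v_{cz}\,\mathrm{d}x=0$, $$\int_S|\nabla f|^2\,\mathrm{d}x\;\le\; C\,D_\ell(f),\qquad D_\ell(f):=\int_S\bigl|\nabla\bigl(-\Delta f+G''(v_c)f\bigr)\bigr|^2\,\mathrm{d}x,$$ where the derivatives of $f$ are taken in the weak sense. -/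

import Mathlib

open MeasureTheory
open scoped ContDiff

namespace CahnHilliard

/-- The strip `S = Q × ℝ` in dimension `d = n + 1`, where `Q = ℝⁿ / ℤⁿ` is the flat unit torus.
Its measure `volume` is the product of the Haar probability measure of `Q` with Lebesgue
measure on `ℝ`. -/
abbrev Strip (n : ℕ) : Type := (Fin n → UnitAddCircle) × ℝ

/-- The canonical projection `ℝⁿ × ℝ → S`. -/
def proj {n : ℕ} (y : (Fin n → ℝ) × ℝ) : Strip n :=
  (fun i => (y.1 i : UnitAddCircle), y.2)

/-- The coordinate directions of the strip: `Sum.inl i` is the `i`-th direction of the torus,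
`Sum.inr ()` is the direction of the unbounded variable `z`. -/
abbrev Dir (n : ℕ) : Type := Fin n ⊕ Unit

/-- The displacement by `t` along a coordinate direction, as an element of the group `S`. -/
def step {n : ℕ} : Dir n → ℝ → Strip n
  | Sum.inl i, t => (Pi.single i (t : UnitAddCircle), 0)
  | Sum.inr _, t => (0, t)

/-- The classical partial derivative of a function on the strip. -/
noncomputable def partialDeriv {n : ℕ} (j : Dir n) (φ : Strip n → ℝ) (p : Strip n) : ℝ :=
  deriv (fun t : ℝ => φ (p + step j t)) 0

/-- The test functions `C_c^∞(S)`. Smoothness is tested on the covering space `ℝⁿ × ℝ`. -/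
structure IsTestFunction {n : ℕ} (φ : Strip n → ℝ) : Prop where
  smooth : ContDiff ℝ ∞ (fun y : (Fin n → ℝ) × ℝ => φ (proj y))
  compact : HasCompactSupport φ

/-- `g` is a weak (distributional) partial derivative of `f` in the direction `j`. -/
def HasWeakDeriv {n : ℕ} (j : Dir n) (f g : Strip n → ℝ) : Prop :=
  LocallyIntegrable f volume ∧ LocallyIntegrable g volume ∧
    ∀ φ : Strip n → ℝ, IsTestFunction φ →
      ∫ p, f p * partialDeriv j φ p = - ∫ p, g p * φ p

/-- The Sobolev space `H^k(S)`: all weak derivatives up to order `k` exist and lie in `L²(S)`. -/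
def MemSobolev {n : ℕ} : ℕ → (Strip n → ℝ) → Prop
  | 0, f => MemLp f 2 volume
  | k + 1, f => MemLp f 2 volume ∧ ∀ j : Dir n, ∃ g, HasWeakDeriv j f g ∧ MemSobolev k g

open Classical in
/-- A representative of the weak partial derivative of `f` (which is unique up to null sets) where
it exists as a locally integrable function, and `0` otherwise. -/
noncomputable def weakDeriv {n : ℕ} (j : Dir n) (f : Strip n → ℝ) : Strip n → ℝ :=
  if h : ∃ g, HasWeakDeriv j f g then h.choose else 0

/-- The (distributional) Laplacian on the strip. -/
noncomputable def weakLaplacian {n : ℕ} (f : Strip n → ℝ) (p : Strip n) : ℝ :=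
  ∑ j : Dir n, weakDeriv j (weakDeriv j f) p

/-- The Dirichlet integral `∫_S |∇f|²`. -/
noncomputable def gradNormSq {n : ℕ} (f : Strip n → ℝ) : ℝ :=
  ∫ p, ∑ j : Dir n, (weakDeriv j f p) ^ 2

/-- The standard double well potential `G(u) = (1 - u²)² / 4`. -/
noncomputable def doubleWell (u : ℝ) : ℝ := (1 - u ^ 2) ^ 2 / 4

/-- The kink `v_c(z) = v_0(z - c)`, with `v_0(z) = tanh (z / √2)`. -/
noncomputable def kink (c z : ℝ) : ℝ := Real.tanh ((z - c) / √2)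

/-- The linearized operator `f ↦ -Δf + G''(v_c) f`. -/
noncomputable def linOp {n : ℕ} (c : ℝ) (f : Strip n → ℝ) (p : Strip n) : ℝ :=
  - weakLaplacian f p + deriv (deriv doubleWell) (kink c p.2) * f p

/-- The linearized dissipation `D_ℓ(f) = ∫_S |∇(-Δf + G''(v_c) f)|²`. -/
noncomputable def linDissipation {n : ℕ} (c : ℝ) (f : Strip n → ℝ) : ℝ :=
  gradNormSq (linOp c f)

end CahnHilliard

namespace CahnHilliard

open UnitAddTorus Filter Topology

/-! Write v for the kink, s = v' for its slope, V = 3v² - 1 = G''(v) and L = -∂² + V on the line. A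
Fourier expansion in the torus variable decouples the problem. The coefficients u of f and w of -Δf
+ G''(v)f at frequency k satisfy -u'' + (V + μ)u = w with μ = |2πk|², and by Parseval
(`hasSum_sq_strip`) it suffices to show μ∫u² + ∫u'² ≤ C(μ∫w² + ∫w'²) for each mode, with C
independent of k (`mode_estimate`).

Everything rests on the factorization L = A*A with A = ∂ + √2 v and A* = -∂ + √2 v, where As = 0.
For k ≠ 0 one has μ ≥ 4, and L ≥ 0 gives μ²∫u² ≤ ∫w², from which the bound follows without w'
(`integral_sq_le_of_four_le`).

For k = 0 the bound must use w' alone. Since Ls = 0, w is orthogonal to s, and a Poincaré inequality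
with weight s bounds ∫sw² by the first moment of s times ∫w'² (`integral_kinkSlope_mul_sq_le`).
Inverting the two first-order factors in the same weighted norm bounds ∫s(Au)² and then, by the
orthogonality of u to s, ∫su² (`integral_kinkSlope_mul_factor_sq_le`,
`integral_kinkSlope_mul_sq_le_factor`). Away from the kink V is close to 2, so testing the equation
with u'' bounds ∫u'² up to terms with weight s, which are already controlled
(`integral_sq_deriv_le`). -/

instance : IsProbabilityMeasure (volume : Measure UnitAddCircle) :=
  ⟨UnitAddCircle.measure_univ⟩

/-! ### Real Fourier analysis on the torus. -/

/-- The real part of the Fourier monomial. -/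
noncomputable def cosMode {n : ℕ} (k : Fin n → ℤ) (x : Fin n → UnitAddCircle) : ℝ :=
  (mFourier k x).re

/-- The imaginary part of the Fourier monomial. -/
noncomputable def sinMode {n : ℕ} (k : Fin n → ℤ) (x : Fin n → UnitAddCircle) : ℝ :=
  (mFourier k x).im

theorem continuous_cosMode {n : ℕ} (k : Fin n → ℤ) : Continuous (cosMode k) :=
  Complex.continuous_re.comp (mFourier k).continuous

theorem continuous_sinMode {n : ℕ} (k : Fin n → ℤ) : Continuous (sinMode k) :=
  Complex.continuous_im.comp (mFourier k).continuous

theorem mFourier_coe {n : ℕ} (k : Fin n → ℤ) (y : Fin n → ℝ) :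
    mFourier k (fun i => (y i : UnitAddCircle)) =
      Complex.exp ((2 * Real.pi * ∑ i, (k i : ℝ) * y i : ℝ) * Complex.I) := by
  simp only [mFourier, ContinuousMap.coe_mk, fourier_coe_apply, ← Complex.exp_sum]
  congr 1
  push_cast
  rw [Finset.mul_sum, Finset.sum_mul]
  refine Finset.sum_congr rfl fun i _ => ?_
  simp; ring

theorem cosMode_coe {n : ℕ} (k : Fin n → ℤ) (y : Fin n → ℝ) :
    cosMode k (fun i => (y i : UnitAddCircle)) = Real.cos (2 * Real.pi * ∑ i, (k i : ℝ) * y i) := by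
  rw [cosMode, mFourier_coe, Complex.exp_ofReal_mul_I_re]

theorem sinMode_coe {n : ℕ} (k : Fin n → ℤ) (y : Fin n → ℝ) :
    sinMode k (fun i => (y i : UnitAddCircle)) = Real.sin (2 * Real.pi * ∑ i, (k i : ℝ) * y i) := by
  rw [sinMode, mFourier_coe, Complex.exp_ofReal_mul_I_im]

theorem cosMode_zero {n : ℕ} (x : Fin n → UnitAddCircle) : cosMode 0 x = 1 := by
  simp [cosMode, mFourier_zero]

theorem sinMode_zero {n : ℕ} (x : Fin n → UnitAddCircle) : sinMode 0 x = 0 := by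
  simp [sinMode, mFourier_zero]

theorem measureSpace_unitAddCircle_eq :
    (AddCircle.measureSpace 1 : MeasureSpace UnitAddCircle) = ⟨AddCircle.haarAddCircle⟩ := by
  have h := AddCircle.volume_eq_smul_haarAddCircle (T := 1)
  simp only [ENNReal.ofReal_one, one_smul] at h
  exact congrArg (fun m : Measure UnitAddCircle => (⟨m⟩ : MeasureSpace UnitAddCircle)) h

section Haar

variable [ms : MeasureSpace UnitAddCircle]

/-- Parseval's identity is available for the normalized Haar measure. Keeping the measure space on
the circle as a variable lets `subst` identify it with that one inside the product measure. -/
theorem hasSum_sq_mFourierCoeff_aux (hms : ms = ⟨AddCircle.haarAddCircle⟩) {n : ℕ}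
    {h : (Fin n → UnitAddCircle) → ℂ}
    (hh : MemLp h 2 (@volume _ (@MeasureSpace.pi (Fin n) _ (fun _ => UnitAddCircle) (fun _ => ms)))) :
    HasSum (fun k : Fin n → ℤ => ‖∫ x, mFourier (-k) x * h x
      ∂(@volume _ (@MeasureSpace.pi (Fin n) _ (fun _ => UnitAddCircle) (fun _ => ms)))‖ ^ 2)
      (∫ x, ‖h x‖ ^ 2 ∂(@volume _ (@MeasureSpace.pi (Fin n) _ (fun _ => UnitAddCircle) (fun _ => ms)))) := by
  subst hms
  have key := hasSum_sq_mFourierCoeff (hh.toLp h)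
  have e := hh.coeFn_toLp
  convert! key using 1
  · funext k
    congr 2
    refine integral_congr_ae ?_
    filter_upwards [e] with x hx
    simp [hx]
  · refine integral_congr_ae ?_
    filter_upwards [e] with x hx
    simp [hx]

end Haar

theorem hasSum_sq_torus {n : ℕ} {h : (Fin n → UnitAddCircle) → ℝ} (hh : MemLp h 2 volume) :
    HasSum (fun k : Fin n → ℤ => (∫ x, cosMode k x * h x) ^ 2 + (∫ x, sinMode k x * h x) ^ 2)
      (∫ x, h x ^ 2) := by
  have key := hasSum_sq_mFourierCoeff_aux measureSpace_unitAddCircle_eq (h := fun x => (h x : ℂ))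
    hh.ofReal
  have hi : Integrable h volume := hh.integrable (by norm_num)
  convert! key using 1
  · funext k
    have hint : Integrable (fun x => mFourier (-k) x * (h x : ℂ)) volume := by
      refine (hi.ofReal (𝕜 := ℂ)).bdd_mul (c := 1) (mFourier (-k)).continuous.aestronglyMeasurable
        (Filter.Eventually.of_forall fun x => ?_)
      exact ((mFourier (-k)).norm_coe_le_norm x).trans mFourier_norm.le
    have e := integral_re_add_im hint
    rw [← e, Complex.sq_norm, Complex.normSq_apply]
    have h1 : ∫ x, RCLike.re (mFourier (-k) x * (h x : ℂ)) = ∫ x, cosMode k x * h x := by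
      refine integral_congr_ae (Filter.Eventually.of_forall fun x => ?_)
      simp [cosMode, mFourier_neg]
    have h2 : ∫ x, RCLike.im (mFourier (-k) x * (h x : ℂ)) = - ∫ x, sinMode k x * h x := by
      rw [← integral_neg]
      refine integral_congr_ae (Filter.Eventually.of_forall fun x => ?_)
      simp [sinMode, mFourier_neg]
    rw [h1, h2]
    simp
    ring
  · simp

theorem integrable_continuous_mul_torus {n : ℕ} {h : (Fin n → UnitAddCircle) → ℝ}
    (hh : Integrable h volume) {ψ : (Fin n → UnitAddCircle) → ℝ} (hψ : Continuous ψ) :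
    Integrable (fun x => ψ x * h x) volume := by
  obtain ⟨C, hC⟩ := isCompact_univ.exists_bound_of_continuousOn hψ.continuousOn
  exact hh.bdd_mul (c := C) hψ.aestronglyMeasurable
    (Filter.Eventually.of_forall fun x => hC x trivial)

/-- Integration against `h` is a continuous functional on continuous functions, and it vanishes on
the dense span of the Fourier monomials. -/
theorem integral_continuous_mul_eq_zero {n : ℕ} {h : (Fin n → UnitAddCircle) → ℝ}
    (hh : Integrable h volume) (hc : ∀ k, ∫ x, cosMode k x * h x = 0)
    (hs : ∀ k, ∫ x, sinMode k x * h x = 0) (φ : C((Fin n → UnitAddCircle), ℂ)) :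
    ∫ x, φ x * (h x : ℂ) = 0 := by
  have hint : ∀ φ : C((Fin n → UnitAddCircle), ℂ),
      Integrable (fun x => φ x * (h x : ℂ)) volume := fun φ =>
    (hh.ofReal (𝕜 := ℂ)).bdd_mul (c := ‖φ‖) φ.continuous.aestronglyMeasurable
        (Filter.Eventually.of_forall fun x => φ.norm_coe_le_norm x)
  let l : C((Fin n → UnitAddCircle), ℂ) →ₗ[ℂ] ℂ :=
    { toFun := fun φ => ∫ x, φ x * (h x : ℂ)
      map_add' := fun φ χ => by
        rw [← integral_add (hint φ) (hint χ)]; simp [add_mul]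
      map_smul' := fun c φ => by
        simp only [RingHom.id_apply, smul_eq_mul]
        rw [← integral_const_mul]; simp [mul_assoc] }
  let L := l.mkContinuous (∫ x, ‖h x‖) (fun φ => by
    change ‖∫ x, φ x * (h x : ℂ)‖ ≤ _
    refine (norm_integral_le_integral_norm _).trans ?_
    rw [mul_comm, ← integral_const_mul]
    refine integral_mono (hint φ).norm (hh.norm.const_mul _) fun x => ?_
    simp only [norm_mul, Complex.norm_real]
    exact mul_le_mul_of_nonneg_right (φ.norm_coe_le_norm x) (norm_nonneg _))
  have hker : Submodule.span ℂ (Set.range (mFourier (d := Fin n))) ≤ L.ker := by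
    rw [Submodule.span_le]
    rintro _ ⟨k, rfl⟩
    change ∫ x, mFourier k x * (h x : ℂ) = 0
    have e := integral_re_add_im (hint (mFourier k))
    rw [← e]
    have h1 : ∫ x, RCLike.re (mFourier k x * (h x : ℂ)) = 0 := by
      rw [← hc k]
      refine integral_congr_ae (Filter.Eventually.of_forall fun x => ?_)
      simp [cosMode]
    have h2 : ∫ x, RCLike.im (mFourier k x * (h x : ℂ)) = 0 := by
      rw [← hs k]
      refine integral_congr_ae (Filter.Eventually.of_forall fun x => ?_)
      simp [sinMode]
    rw [h1, h2]
    simp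
  have htop := Submodule.topologicalClosure_minimal _ hker L.isClosed_ker
  rw [span_mFourier_closure_eq_top] at htop
  exact htop (Submodule.mem_top (x := φ))

/-- Parseval does not apply to a merely integrable `h`. Instead, the positive and negative parts are
densities of two finite measures that agree on continuous functions; hence the measures, and then
the densities, coincide. -/
theorem ae_eq_zero_of_torus_coeff_eq_zero {n : ℕ} {h : (Fin n → UnitAddCircle) → ℝ}
    (hh : Integrable h volume) (hc : ∀ k, ∫ x, cosMode k x * h x = 0)
    (hs : ∀ k, ∫ x, sinMode k x * h x = 0) : h =ᵐ[volume] 0 := by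
  let p : (Fin n → UnitAddCircle) → ENNReal := fun x => ENNReal.ofReal (h x)
  let q : (Fin n → UnitAddCircle) → ENNReal := fun x => ENNReal.ofReal (-h x)
  have hp : AEMeasurable p volume := hh.aemeasurable.ennreal_ofReal
  have hq : AEMeasurable q volume := hh.neg.aemeasurable.ennreal_ofReal
  have hpf : ∫⁻ x, p x ≠ ⊤ := (hh.lintegral_lt_top).ne
  have hqf : ∫⁻ x, q x ≠ ⊤ := (hh.neg.lintegral_lt_top).ne
  have : IsFiniteMeasure ((volume : Measure (Fin n → UnitAddCircle)).withDensity p) :=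
    isFiniteMeasure_withDensity hpf
  have : IsFiniteMeasure ((volume : Measure (Fin n → UnitAddCircle)).withDensity q) :=
    isFiniteMeasure_withDensity hqf
  have heq : (volume : Measure (Fin n → UnitAddCircle)).withDensity p = volume.withDensity q := by
    refine ext_of_forall_integral_eq_of_IsFiniteMeasure fun φ => ?_
    rw [integral_withDensity_eq_integral_toReal_smul₀ hp
        (Filter.Eventually.of_forall fun x => ENNReal.ofReal_lt_top),
      integral_withDensity_eq_integral_toReal_smul₀ hq
        (Filter.Eventually.of_forall fun x => ENNReal.ofReal_lt_top)]
    have h0 := integral_continuous_mul_eq_zero hh hc hs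
      ⟨fun x => (φ x : ℂ), Complex.continuous_ofReal.comp φ.continuous⟩
    simp only [ContinuousMap.coe_mk, ← Complex.ofReal_mul] at h0
    rw [integral_complex_ofReal] at h0
    have h0' : ∫ x, φ x * h x = 0 := by exact_mod_cast h0
    have i1 := integrable_continuous_mul_torus hh.pos_part φ.continuous
    have i2 := integrable_continuous_mul_torus hh.neg_part φ.continuous
    rw [← sub_eq_zero, ← h0']
    have e1 : ∀ x, (p x).toReal • φ x = φ x * max (h x) 0 := fun x => by
      rw [ENNReal.toReal_ofReal', smul_eq_mul, mul_comm]
    have e2 : ∀ x, (q x).toReal • φ x = φ x * max (-h x) 0 := fun x => by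
      rw [ENNReal.toReal_ofReal', smul_eq_mul, mul_comm]
    simp only [e1, e2]
    rw [← integral_sub i1 i2]
    refine integral_congr_ae (Filter.Eventually.of_forall fun x => ?_)
    rcases le_total (h x) 0 with hx | hx
    · simp [hx]
    · simp [hx]
  rw [withDensity_eq_iff hp hq hpf] at heq
  filter_upwards [heq] with x hx
  have hx' : ENNReal.ofReal (h x) = ENNReal.ofReal (-h x) := hx
  rcases le_total (h x) 0 with h0 | h0
  · rw [ENNReal.ofReal_of_nonpos h0, eq_comm, ENNReal.ofReal_eq_zero] at hx'
    simp; linarith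
  · rw [ENNReal.ofReal_of_nonpos (neg_nonpos.2 h0), ENNReal.ofReal_eq_zero] at hx'
    simp; linarith

/-! ### Absolutely continuous functions and weak derivatives on the line. -/

/-- `q` is locally absolutely continuous with derivative `q₁`. -/
def IsPrimitive (q q₁ : ℝ → ℝ) : Prop :=
  LocallyIntegrable q₁ volume ∧ ∀ a b, q b - q a = ∫ z in a..b, q₁ z

theorem LocallyIntegrable.intervalIntegrable' {q : ℝ → ℝ} (h : LocallyIntegrable q volume)
    (a b : ℝ) : IntervalIntegrable q volume a b :=
  (h.integrableOn_isCompact isCompact_uIcc).intervalIntegrable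

theorem IsPrimitive.continuous {q q₁ : ℝ → ℝ} (h : IsPrimitive q q₁) : Continuous q := by
  have e : q = fun z => q 0 + ∫ t in (0 : ℝ)..z, q₁ t := by
    funext z; rw [← h.2 0 z]; ring
  rw [e]
  exact continuous_const.add (intervalIntegral.continuous_primitive
    (fun a b => LocallyIntegrable.intervalIntegrable' h.1 a b) 0)

theorem IsPrimitive.of_hasDerivAt {p p₁ : ℝ → ℝ} (hp : ∀ x, HasDerivAt p (p₁ x) x)
    (hc : Continuous p₁) : IsPrimitive p p₁ :=
  ⟨hc.locallyIntegrable, fun _ _ => (intervalIntegral.integral_eq_sub_of_hasDerivAt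
    (fun x _ => hp x) (hc.intervalIntegrable _ _)).symm⟩

theorem IsPrimitive.hasDerivAt {q q₁ : ℝ → ℝ} (h : IsPrimitive q q₁) (hc : Continuous q₁) (x : ℝ) :
    HasDerivAt q (q₁ x) x := by
  have e : q = fun z => q 0 + ∫ t in (0 : ℝ)..z, q₁ t := by
    funext z; rw [← h.2 0 z]; ring
  rw [e]
  exact (intervalIntegral.integral_hasDerivAt_right (hc.intervalIntegrable _ _)
    (hc.stronglyMeasurableAtFilter _ _) hc.continuousAt).const_add _

theorem IsPrimitive.ac {q q₁ : ℝ → ℝ} (h : IsPrimitive q q₁) (a b : ℝ) :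
    AbsolutelyContinuousOnInterval q a b := by
  have e : q = fun z => q a + ∫ t in a..z, q₁ t := by
    funext z; rw [← h.2 a z]; ring
  rw [e]
  refine AbsolutelyContinuousOnInterval.fun_add ?_ ?_
  · exact ContDiffOn.absolutelyContinuousOnInterval contDiffOn_const
  · exact (LocallyIntegrable.intervalIntegrable' h.1 a b).absolutelyContinuousOnInterval_intervalIntegral
      Set.left_mem_uIcc

theorem IsPrimitive.ae_hasDerivAt {q q₁ : ℝ → ℝ} (h : IsPrimitive q q₁) (a b : ℝ) :
    ∀ᵐ x, x ∈ Set.uIcc a b → HasDerivAt q (q₁ x) x := by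
  filter_upwards [(LocallyIntegrable.intervalIntegrable' h.1 a b).ae_hasDerivAt_integral] with x hx hxm
  have e : q = fun z => q a + ∫ t in a..z, q₁ t := by
    funext z; rw [← h.2 a z]; ring
  rw [e]
  exact (hx hxm a Set.left_mem_uIcc).const_add _

theorem IsPrimitive.mul {p p₁ q q₁ : ℝ → ℝ} (hp : IsPrimitive p p₁) (hq : IsPrimitive q q₁) :
    IsPrimitive (fun z => p z * q z) (fun z => p₁ z * q z + p z * q₁ z) := by
  constructor
  · refine LocallyIntegrable.add ?_ ?_
    · simpa [mul_comm] using hp.1.continuous_smul hq.continuous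
    · simpa using hq.1.continuous_smul hp.continuous
  · intro a b
    rw [← (hp.ac a b).integral_deriv_mul_eq_sub (hq.ac a b)]
    refine intervalIntegral.integral_congr_ae ?_
    filter_upwards [hp.ae_hasDerivAt a b, hq.ae_hasDerivAt a b] with x h1 h2 hx
    have hx' := Set.uIoc_subset_uIcc hx
    rw [(h1 hx').deriv, (h2 hx').deriv]

/-- Integrability of `q₁` gives a limit; integrability of `q` forces it to be zero. -/
theorem IsPrimitive.tendsto_atTop {q q₁ : ℝ → ℝ} (h : IsPrimitive q q₁) (hi : Integrable q volume)
    (hi1 : Integrable q₁ volume) : Tendsto q atTop (𝓝 0) := by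
  have t : Tendsto (fun z => q 0 + ∫ t in (0 : ℝ)..z, q₁ t) atTop
      (𝓝 (q 0 + ∫ t in Set.Ioi (0 : ℝ), q₁ t)) :=
    (intervalIntegral_tendsto_integral_Ioi 0 hi1.integrableOn tendsto_id).const_add _
  have e : q = fun z => q 0 + ∫ t in (0 : ℝ)..z, q₁ t := by
    funext z; rw [← h.2 0 z]; ring
  rw [← e] at t
  have hz : q 0 + ∫ t in Set.Ioi (0 : ℝ), q₁ t = 0 :=
    IntegrableAtFilter.eq_zero_of_tendsto (μ := volume) (hi.integrableAtFilter _) (fun s hs => by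
      obtain ⟨b, hb⟩ := mem_atTop_sets.1 hs
      rw [← top_le_iff, ← Real.volume_Ici (a := b)]
      exact measure_mono hb) t
  rwa [hz] at t

theorem IsPrimitive.tendsto_atBot {q q₁ : ℝ → ℝ} (h : IsPrimitive q q₁) (hi : Integrable q volume)
    (hi1 : Integrable q₁ volume) : Tendsto q atBot (𝓝 0) := by
  have t : Tendsto (fun z => q 0 - ∫ t in z..(0 : ℝ), q₁ t) atBot
      (𝓝 (q 0 - ∫ t in Set.Iic (0 : ℝ), q₁ t)) :=
    (intervalIntegral_tendsto_integral_Iic 0 hi1.integrableOn tendsto_id).const_sub _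
  have e : q = fun z => q 0 - ∫ t in z..(0 : ℝ), q₁ t := by
    funext z; rw [← h.2 z 0]; ring
  rw [← e] at t
  have hz : q 0 - ∫ t in Set.Iic (0 : ℝ), q₁ t = 0 :=
    IntegrableAtFilter.eq_zero_of_tendsto (μ := volume) (hi.integrableAtFilter _) (fun s hs => by
      obtain ⟨b, hb⟩ := mem_atBot_sets.1 hs
      rw [← top_le_iff, ← Real.volume_Iic (a := b)]
      exact measure_mono hb) t
  rwa [hz] at t

theorem IsPrimitive.integral_eq_zero {q q₁ : ℝ → ℝ} (h : IsPrimitive q q₁)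
    (hi : Integrable q volume) (hi1 : Integrable q₁ volume) : ∫ z, q₁ z = 0 := by
  have t1 := intervalIntegral_tendsto_integral (μ := volume) hi1 tendsto_neg_atTop_atBot tendsto_id
  have t2 := (h.tendsto_atTop hi hi1).sub ((h.tendsto_atBot hi hi1).comp tendsto_neg_atTop_atBot)
  simp only [sub_zero] at t2
  refine tendsto_nhds_unique t1 (t2.congr fun z => ?_)
  simpa using h.2 (-z) z

theorem IsPrimitive.integral_mul_eq {p p₁ q q₁ : ℝ → ℝ} (hp : IsPrimitive p p₁)
    (hq : IsPrimitive q q₁) (h0 : Integrable (fun z => p z * q z) volume)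
    (h1 : Integrable (fun z => p₁ z * q z) volume) (h2 : Integrable (fun z => p z * q₁ z) volume) :
    ∫ z, p z * q₁ z = - ∫ z, p₁ z * q z := by
  have := (hp.mul hq).integral_eq_zero h0 (h1.add h2)
  rw [integral_add h1 h2] at this
  linarith

/-- The weak derivative on the real line. -/
def HasWeakDerivReal (u u₁ : ℝ → ℝ) : Prop :=
  ∀ η : ℝ → ℝ, ContDiff ℝ ∞ η → HasCompactSupport η → ∫ z, u z * deriv η z = - ∫ z, u₁ z * η z

theorem LocallyIntegrable.integrable_mul_of_compact {u η : ℝ → ℝ} (hu : LocallyIntegrable u volume)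
    (hη : Continuous η) (hc : HasCompactSupport η) : Integrable (fun z => u z * η z) volume := by
  simpa [mul_comm] using hu.integrable_smul_left_of_hasCompactSupport hη hc

/-- The primitive from -∞ vanishes to the left of the support, and mean zero makes it vanish to the
right. -/
theorem exists_testFunction_primitive {ξ : ℝ → ℝ} (hξ : ContDiff ℝ ∞ ξ) (hc : HasCompactSupport ξ)
    (h0 : ∫ z, ξ z = 0) :
    ∃ η : ℝ → ℝ, ContDiff ℝ ∞ η ∧ HasCompactSupport η ∧ deriv η = ξ := by
  obtain ⟨R, hR⟩ := hc.isCompact.isBounded.subset_closedBall (0 : ℝ)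
  have hout : ∀ x, R < |x| → ξ x = 0 := fun x hx => by
    by_contra hne
    have := hR (subset_tsupport _ hne)
    rw [mem_closedBall_zero_iff, Real.norm_eq_abs] at this
    linarith
  have hcont := hξ.continuous
  have hint : Integrable ξ volume := hcont.integrable_of_hasCompactSupport hc
  let η : ℝ → ℝ := fun z => ∫ t in Set.Iic z, ξ t
  have hd : ∀ x, HasDerivAt η (ξ x) x := fun x => by
    have e : η = fun z => (∫ t in Set.Iic (0 : ℝ), ξ t) + ∫ t in (0 : ℝ)..z, ξ t := by
      funext z
      rw [← intervalIntegral.integral_Iic_sub_Iic hint.integrableOn hint.integrableOn]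
      ring
    rw [e]
    exact (intervalIntegral.integral_hasDerivAt_right (hcont.intervalIntegrable _ _)
      (hcont.stronglyMeasurableAtFilter _ _) hcont.continuousAt).const_add _
  have hde : deriv η = ξ := funext fun x => (hd x).deriv
  refine ⟨η, ?_, ?_, hde⟩
  · rw [contDiff_infty_iff_deriv, hde]
    exact ⟨fun x => (hd x).differentiableAt, hξ⟩
  · refine HasCompactSupport.of_support_subset_isCompact (isCompact_Icc (a := -R) (b := R))
      fun x hx => ?_
    by_contra hx'
    apply hx
    rw [Set.mem_Icc, not_and_or, not_le, not_le] at hx'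
    change ∫ t in Set.Iic x, ξ t = 0
    rcases hx' with h | h
    · refine setIntegral_eq_zero_of_forall_eq_zero fun t ht => hout t ?_
      rw [lt_abs]; right; linarith [Set.mem_Iic.1 ht]
    · have h2 : ∫ t in Set.Ioi x, ξ t = 0 :=
        setIntegral_eq_zero_of_forall_eq_zero fun t ht => hout t (by
          rw [lt_abs]; left; linarith [Set.mem_Ioi.1 ht])
      have := intervalIntegral.integral_Iic_add_Ioi (b := x) hint.integrableOn hint.integrableOn
      linarith

theorem exists_ae_eq_const_of_weakDeriv_zero {d : ℝ → ℝ} (hd : LocallyIntegrable d volume)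
    (h : ∀ η : ℝ → ℝ, ContDiff ℝ ∞ η → HasCompactSupport η → ∫ z, d z * deriv η z = 0) :
    ∃ κ : ℝ, ∀ᵐ z, d z = κ := by
  let b : ContDiffBump (0 : ℝ) := ⟨1, 2, one_pos, one_lt_two⟩
  let η₀ : ℝ → ℝ := b.normed volume
  have hη₀ : ContDiff ℝ ∞ η₀ := b.contDiff_normed
  have hη₀c : HasCompactSupport η₀ := b.hasCompactSupport_normed
  have hη₀i : ∫ z, η₀ z = 1 := b.integral_normed
  refine ⟨∫ z, d z * η₀ z, ?_⟩
  refine ae_eq_of_integral_contDiff_smul_eq hd (locallyIntegrable_const _) fun η hη hηc => ?_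
  have i1 : Integrable η volume := hη.continuous.integrable_of_hasCompactSupport hηc
  have i0 : Integrable η₀ volume := hη₀.continuous.integrable_of_hasCompactSupport hη₀c
  -- Subtracting (∫η)η₀ gives mean zero, so the difference is the derivative of a test function and
  -- is annihilated by `d`.
  obtain ⟨Ξ, hΞ, hΞc, hΞd⟩ := exists_testFunction_primitive
    (ξ := fun z => η z - (∫ t, η t) * η₀ z) (hη.sub (contDiff_const.mul hη₀))
    (hηc.sub (hη₀c.mul_left)) (by
      rw [integral_sub i1 (i0.const_mul _), integral_const_mul, hη₀i]; ring)
  have key := h Ξ hΞ hΞc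
  rw [hΞd] at key
  have j1 := LocallyIntegrable.integrable_mul_of_compact hd hη.continuous hηc
  have j0 := LocallyIntegrable.integrable_mul_of_compact hd hη₀.continuous hη₀c
  have e : ∀ z, d z * (η z - (∫ t, η t) * η₀ z) = d z * η z - (∫ t, η t) * (d z * η₀ z) :=
    fun z => by ring
  simp only [e] at key
  rw [integral_sub j1 (j0.const_mul _), integral_const_mul] at key
  simp only [smul_eq_mul]
  rw [integral_mul_const]
  simp only [mul_comm (η _)]
  linarith

theorem IsPrimitive.hasWeakDerivReal {q q₁ : ℝ → ℝ} (h : IsPrimitive q q₁) :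
    HasWeakDerivReal q q₁ := fun η hη hc => by
  have hη1 : Continuous (deriv η) := hη.continuous_deriv (by simp)
  have hp : IsPrimitive η (deriv η) := IsPrimitive.of_hasDerivAt
    (fun x => (hη.differentiable (by simp) x).hasDerivAt) hη1
  have hql := h.continuous.locallyIntegrable (μ := volume)
  have := hp.integral_mul_eq h
    (by simpa [mul_comm] using LocallyIntegrable.integrable_mul_of_compact hql hη.continuous hc)
    (by simpa [mul_comm] using LocallyIntegrable.integrable_mul_of_compact hql hη1 hc.deriv)
    (by simpa [mul_comm] using LocallyIntegrable.integrable_mul_of_compact h.1 hη.continuous hc)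
  simp only [mul_comm (η _), mul_comm (deriv η _)] at this
  linarith

/-- **du Bois-Reymond**: a function with a locally integrable weak derivative has a locally
absolutely continuous representative. -/
theorem HasWeakDerivReal.exists_isPrimitive {u u₁ : ℝ → ℝ} (h : HasWeakDerivReal u u₁)
    (hu : LocallyIntegrable u volume) (hu1 : LocallyIntegrable u₁ volume) :
    ∃ U : ℝ → ℝ, IsPrimitive U u₁ ∧ U =ᵐ[volume] u := by
  let U : ℝ → ℝ := fun z => ∫ t in (0 : ℝ)..z, u₁ t
  have hU : IsPrimitive U u₁ := ⟨hu1, fun a b =>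
    intervalIntegral.integral_interval_sub_left (LocallyIntegrable.intervalIntegrable' hu1 _ _)
      (LocallyIntegrable.intervalIntegrable' hu1 _ _)⟩
  have hUl := hU.continuous.locallyIntegrable (μ := volume)
  obtain ⟨κ, hκ⟩ := exists_ae_eq_const_of_weakDeriv_zero (hu.sub hUl) fun η hη hc => by
    have hη1 : Continuous (deriv η) := hη.continuous_deriv (by simp)
    have e : ∀ z, (u - U) z * deriv η z = u z * deriv η z - U z * deriv η z := fun z => by
      simp [sub_mul]
    simp only [e]
    rw [integral_sub (LocallyIntegrable.integrable_mul_of_compact hu hη1 hc.deriv)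
      (LocallyIntegrable.integrable_mul_of_compact hUl hη1 hc.deriv), h η hη hc,
      hU.hasWeakDerivReal η hη hc, sub_self]
  refine ⟨fun z => κ + U z, ⟨hu1, fun a b => by rw [← hU.2 a b]; ring⟩, ?_⟩
  filter_upwards [hκ] with z hz
  simp only [Pi.sub_apply] at hz
  linarith

/-! ### The kink, its slope and the potential. -/

/-- The derivative `v_{cz} = (1 - v_c²) / √2` of the kink. -/
noncomputable def kinkSlope (c z : ℝ) : ℝ := (1 - kink c z ^ 2) / √2

theorem sqrt_two_mul_kinkSlope (c z : ℝ) : √2 * kinkSlope c z = 1 - kink c z ^ 2 := by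
  rw [kinkSlope]; field_simp

theorem kink_eq_sinh_div_cosh (c z : ℝ) :
    kink c z = Real.sinh ((z - c) / √2) / Real.cosh ((z - c) / √2) :=
  Real.tanh_eq_sinh_div_cosh _

theorem hasDerivAt_kink (c z : ℝ) : HasDerivAt (kink c) (kinkSlope c z) z := by
  have h1 : HasDerivAt (fun z : ℝ => (z - c) / √2) (1 / √2) z :=
    ((hasDerivAt_id z).sub_const c).div_const _
  have hc := (Real.cosh_pos ((z - c) / √2)).ne'
  have h2 := h1.sinh.div h1.cosh hc
  have e : kink c = (fun z => Real.sinh ((z - c) / √2)) / fun z => Real.cosh ((z - c) / √2) :=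
    funext fun z => kink_eq_sinh_div_cosh c z
  rw [e]
  refine h2.congr_deriv ?_
  simp only [kinkSlope, kink_eq_sinh_div_cosh]
  field_simp

theorem deriv_kink (c : ℝ) : deriv (kink c) = kinkSlope c :=
  funext fun z => (hasDerivAt_kink c z).deriv

theorem hasDerivAt_kinkSlope (c z : ℝ) :
    HasDerivAt (kinkSlope c) (-(√2 * kink c z * kinkSlope c z)) z := by
  have h := (((hasDerivAt_kink c z).pow 2).const_sub 1).div_const √2
  refine h.congr_deriv ?_
  field_simp
  push_cast
  rw [Real.sq_sqrt (by norm_num)]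
  ring

theorem continuous_kink (c : ℝ) : Continuous (kink c) :=
  continuous_iff_continuousAt.2 fun z => (hasDerivAt_kink c z).continuousAt

theorem continuous_kinkSlope (c : ℝ) : Continuous (kinkSlope c) :=
  continuous_iff_continuousAt.2 fun z => (hasDerivAt_kinkSlope c z).continuousAt

theorem kink_sq_lt_one (c z : ℝ) : kink c z ^ 2 < 1 := Real.tanh_sq_lt_one _

theorem abs_kink_le_one (c z : ℝ) : |kink c z| ≤ 1 := (Real.abs_tanh_lt_one _).le

theorem kinkSlope_pos (c z : ℝ) : 0 < kinkSlope c z :=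
  div_pos (by linarith [kink_sq_lt_one c z]) (by positivity)

theorem kinkSlope_le_one (c z : ℝ) : kinkSlope c z ≤ 1 := by
  have h := sqrt_two_mul_kinkSlope c z
  have h1 : (1 : ℝ) ≤ √2 := Real.one_le_sqrt.2 (by norm_num)
  nlinarith [kinkSlope_pos c z, sq_nonneg (kink c z)]

theorem abs_kinkSlope_le_one (c z : ℝ) : |kinkSlope c z| ≤ 1 := by
  rw [abs_of_pos (kinkSlope_pos c z)]; exact kinkSlope_le_one c z

theorem contDiff_kink (c : ℝ) : ContDiff ℝ ∞ (kink c) := by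
  have e : kink c = fun z => Real.sinh ((z - c) / √2) / Real.cosh ((z - c) / √2) :=
    funext fun z => kink_eq_sinh_div_cosh c z
  rw [e]
  have h : ContDiff ℝ ∞ fun z : ℝ => (z - c) / √2 := (contDiff_id.sub contDiff_const).div_const _
  exact (Real.contDiff_sinh.comp h).div (Real.contDiff_cosh.comp h)
    fun z => (Real.cosh_pos _).ne'

theorem one_add_sq_le_cosh (x : ℝ) : 1 + x ^ 2 / 2 ≤ Real.cosh x := by
  have h1 : Real.cosh x = 1 + 2 * Real.sinh (x / 2) ^ 2 := by
    have := Real.cosh_two_mul (x / 2)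
    rw [mul_div_cancel₀ x two_ne_zero, Real.cosh_sq] at this
    linarith
  have h2 : (x / 2) ^ 2 ≤ Real.sinh (x / 2) ^ 2 := by
    rcases le_total 0 (x / 2) with h | h
    · exact pow_le_pow_left₀ h (Real.self_le_sinh_iff.2 h) 2
    · have := Real.sinh_le_self_iff.2 h
      nlinarith
  nlinarith

/-- √2 s = 1/cosh², and cosh x ≥ 1 + x²/2. This quartic decay is enough for a finite first moment.
-/
theorem kinkSlope_le (c z : ℝ) : kinkSlope c z * (1 + (z - c) ^ 2 / 4) ^ 2 ≤ 1 := by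
  set x := (z - c) / √2 with hx
  have hs : √2 ^ 2 = 2 := Real.sq_sqrt (by norm_num)
  have hx2 : x ^ 2 / 2 = (z - c) ^ 2 / 4 := by rw [hx, div_pow, hs]; ring
  have hc := one_add_sq_le_cosh x
  rw [hx2] at hc
  have hcp := Real.cosh_pos x
  have h1 : √2 * kinkSlope c z = 1 / Real.cosh x ^ 2 := by
    rw [sqrt_two_mul_kinkSlope, kink_eq_sinh_div_cosh, ← hx]
    have := Real.cosh_sq x
    field_simp
    linarith
  have h3 : kinkSlope c z ≤ 1 / Real.cosh x ^ 2 := by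
    rw [← h1]
    have : (1 : ℝ) ≤ √2 := Real.one_le_sqrt.2 (by norm_num)
    nlinarith [kinkSlope_pos c z]
  calc kinkSlope c z * (1 + (z - c) ^ 2 / 4) ^ 2
      ≤ 1 / Real.cosh x ^ 2 * Real.cosh x ^ 2 := by
        gcongr
    _ = 1 := by field_simp

theorem integrable_kinkSlope (c : ℝ) : Integrable (kinkSlope c) volume := by
  have h0 : Integrable (fun z : ℝ => 16 * (1 + (z - c) ^ 2)⁻¹) volume :=
    (integrable_inv_one_add_sq.comp_sub_right c).const_mul 16
  refine h0.mono' (continuous_kinkSlope c).aestronglyMeasurable (Eventually.of_forall fun z => ?_)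
  rw [Real.norm_eq_abs, abs_of_pos (kinkSlope_pos c z), ← div_eq_mul_inv, le_div_iff₀ (by positivity)]
  nlinarith [kinkSlope_le c z, kinkSlope_pos c z, sq_nonneg (z - c), mul_nonneg (kinkSlope_pos c z).le (sq_nonneg ((z - c) ^ 2)),
    mul_nonneg (kinkSlope_pos c z).le (sq_nonneg (z - c))]

theorem integrable_kinkSlope_mul_abs (c : ℝ) :
    Integrable (fun z => kinkSlope c z * |z - c|) volume := by
  have h0 : Integrable (fun z : ℝ => 16 * (1 + (z - c) ^ 2)⁻¹) volume :=
    (integrable_inv_one_add_sq.comp_sub_right c).const_mul 16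
  refine h0.mono' ((continuous_kinkSlope c).mul (by fun_prop)).aestronglyMeasurable
    (Eventually.of_forall fun z => ?_)
  have hs := kinkSlope_pos c z
  rw [Real.norm_eq_abs, abs_of_nonneg (by positivity), ← div_eq_mul_inv, le_div_iff₀ (by positivity)]
  -- With t = z - c the right-hand side is (4 + t²)², which explains the factor 16.
  have h1 : |z - c| * (1 + (z - c) ^ 2) ≤ 16 * (1 + (z - c) ^ 2 / 4) ^ 2 := by
    have h2 : |z - c| ≤ 1 + (z - c) ^ 2 := by
      rw [← sq_abs (z - c)]; nlinarith [sq_nonneg (|z - c| - 1), abs_nonneg (z - c)]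
    nlinarith [sq_nonneg (z - c), sq_nonneg ((z - c) ^ 2)]
  nlinarith [kinkSlope_le c z, mul_le_mul_of_nonneg_left h1 hs.le]

/-- The first absolute moment of the kink slope, which does not depend on the centre. -/
noncomputable def kinkMoment : ℝ := ∫ z, kinkSlope 0 z * |z - 0|

theorem integral_kinkSlope_mul_abs (c : ℝ) : ∫ z, kinkSlope c z * |z - c| = kinkMoment := by
  rw [kinkMoment, ← integral_sub_right_eq_self (fun z => kinkSlope 0 z * |z - 0|) c]
  simp [kinkSlope, kink]

theorem kinkMoment_nonneg : 0 ≤ kinkMoment :=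
  integral_nonneg fun z => mul_nonneg (kinkSlope_pos 0 z).le (abs_nonneg _)

theorem memLp_kinkSlope (c : ℝ) : MemLp (kinkSlope c) 2 volume := by
  rw [memLp_two_iff_integrable_sq (continuous_kinkSlope c).aestronglyMeasurable]
  refine (integrable_kinkSlope c).mono' ((continuous_kinkSlope c).pow 2).aestronglyMeasurable
    (Eventually.of_forall fun z => ?_)
  have h := kinkSlope_pos c z
  rw [Real.norm_eq_abs, abs_of_nonneg (by positivity)]
  nlinarith [kinkSlope_le_one c z]

/-- Equality holds, but the inequality needs only |v| ≤ 1 and not the limit of tanh at infinity. -/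
theorem integral_Iic_kinkSlope_le (c z : ℝ) : ∫ t in Set.Iic z, kinkSlope c t ≤ 1 + kink c z := by
  refine le_of_tendsto (intervalIntegral_tendsto_integral_Iic z
    (integrable_kinkSlope c).integrableOn tendsto_id) (Eventually.of_forall fun b => ?_)
  rw [intervalIntegral.integral_eq_sub_of_hasDerivAt (fun x _ => hasDerivAt_kink c x)
    ((continuous_kinkSlope c).intervalIntegrable _ _)]
  linarith [(abs_le.1 (abs_kink_le_one c (id b))).1]

theorem integral_Ioi_kinkSlope_le (c z : ℝ) : ∫ t in Set.Ioi z, kinkSlope c t ≤ 1 - kink c z := by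
  refine le_of_tendsto (intervalIntegral_tendsto_integral_Ioi z
    (integrable_kinkSlope c).integrableOn tendsto_id) (Eventually.of_forall fun b => ?_)
  rw [intervalIntegral.integral_eq_sub_of_hasDerivAt (fun x _ => hasDerivAt_kink c x)
    ((continuous_kinkSlope c).intervalIntegrable _ _)]
  linarith [(abs_le.1 (abs_kink_le_one c (id b))).2]

/-- The potential `G''(v_c) = 3 v_c² - 1`. -/
noncomputable def kinkPotential (c z : ℝ) : ℝ := 3 * kink c z ^ 2 - 1

theorem continuous_kinkPotential (c : ℝ) : Continuous (kinkPotential c) :=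
  ((continuous_kink c).pow 2).const_mul 3 |>.sub continuous_const

theorem hasDerivAt_kinkPotential (c z : ℝ) :
    HasDerivAt (kinkPotential c) (6 * kink c z * kinkSlope c z) z := by
  refine ((((hasDerivAt_kink c z).pow 2).const_mul 3).sub_const 1).congr_deriv ?_
  push_cast; ring

theorem abs_kinkPotential_le (c z : ℝ) : |kinkPotential c z| ≤ 2 := by
  rw [kinkPotential, abs_le]
  constructor <;> nlinarith [kink_sq_lt_one c z, sq_nonneg (kink c z)]

/-! ### Energy estimates for the resolvent equation on the line. -/

theorem integrable_mul_mul_of_memLp {b f g : ℝ → ℝ} (hb : Continuous b) (B : ℝ)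
    (hB : ∀ z, |b z| ≤ B) (hf : MemLp f 2 volume) (hg : MemLp g 2 volume) :
    Integrable (fun z => b z * (f z * g z)) volume :=
  (hf.integrable_mul hg).bdd_mul (c := B) hb.aestronglyMeasurable (Eventually.of_forall hB)

theorem MemLp.bdd_mul_two {b f : ℝ → ℝ} (hb : Continuous b) (B : ℝ)
    (hB : ∀ z, |b z| ≤ B) (hf : MemLp f 2 volume) : MemLp (fun z => b z * f z) 2 volume := by
  refine (hf.const_mul B).of_le (hb.aestronglyMeasurable.mul hf.1) (Eventually.of_forall fun z => ?_)
  rw [norm_mul, norm_mul]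
  exact mul_le_mul_of_nonneg_right ((hB z).trans (le_abs_self B)) (norm_nonneg _)

/-- The pattern of the energy estimates below: `D` is a combination of total derivatives or another
term of integral zero, chosen so that the pointwise inequality becomes algebraic, often a sum of
squares. -/
theorem integral_le_of_le_add {A B D : ℝ → ℝ} (hA : Integrable A volume) (hB : Integrable B volume)
    (hD : Integrable D volume) (hD0 : ∫ z, D z = 0) (h : ∀ z, A z ≤ B z + D z) :
    ∫ z, A z ≤ ∫ z, B z := by
  calc ∫ z, A z ≤ ∫ z, (B z + D z) := integral_mono hA (hB.add hD) h
    _ = ∫ z, B z := by rw [integral_add hB hD, hD0, add_zero]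

/-- An `H²`-solution of `-u'' + (G''(v_c) + μ) u = w` on the real line with `w` in `H¹`. -/
structure IsResolventPair (c μ : ℝ) (u u₁ w w₁ : ℝ → ℝ) : Prop where
  deriv_fst : ∀ z, HasDerivAt u (u₁ z) z
  deriv_snd : ∀ z, HasDerivAt u₁ ((kinkPotential c z + μ) * u z - w z) z
  prim : IsPrimitive w w₁
  memLp_u : MemLp u 2 volume
  memLp_u₁ : MemLp u₁ 2 volume
  memLp_w : MemLp w 2 volume
  memLp_w₁ : MemLp w₁ 2 volume

namespace IsResolventPair

variable {c μ : ℝ} {u u₁ w w₁ : ℝ → ℝ}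

theorem continuous_u (h : IsResolventPair c μ u u₁ w w₁) : Continuous u :=
  continuous_iff_continuousAt.2 fun z => (h.deriv_fst z).continuousAt

theorem continuous_u₁ (h : IsResolventPair c μ u u₁ w w₁) : Continuous u₁ :=
  continuous_iff_continuousAt.2 fun z => (h.deriv_snd z).continuousAt

theorem memLp_snd (h : IsResolventPair c μ u u₁ w w₁) :
    MemLp (fun z => (kinkPotential c z + μ) * u z - w z) 2 volume :=
  (MemLp.bdd_mul_two ((continuous_kinkPotential c).add continuous_const) (2 + |μ|)
    (fun z => (abs_add_le _ _).trans (by linarith [abs_kinkPotential_le c z])) h.memLp_u).sub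
    h.memLp_w

/-- Since w = Lu + μu and L = A*A, expanding the square gives ∫w² = ∫(Lu)² + 2μ∫(Au)² + μ²∫u². This
bounds ∫u², and pairing the equation with u then bounds ∫u'². -/
theorem integral_sq_le_of_four_le (h : IsResolventPair c μ u u₁ w w₁) (hμ : 4 ≤ μ) :
    μ * (∫ z, u z ^ 2) + (∫ z, u₁ z ^ 2) ≤ μ * (∫ z, w z ^ 2) := by
  have cv := continuous_kink c
  have cs := continuous_kinkSlope c
  have hu := h.memLp_u
  have hu₁ := h.memLp_u₁
  have hq := h.memLp_snd
  set q : ℝ → ℝ := fun z => (kinkPotential c z + μ) * u z - w z with hqdef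
  -- `D₁` and `D₂` are the derivatives of u u₁ and √2 v u².
  let D₁ : ℝ → ℝ := fun z => u₁ z * u₁ z + u z * q z
  let D₂ : ℝ → ℝ := fun z => √2 * kinkSlope c z * (u z * u z) + 2 * √2 * kink c z * (u z * u₁ z)
  have hr0 := Real.sqrt_nonneg 2
  have r2 : √2 ^ 2 = 2 := Real.sq_sqrt (by norm_num)
  have iD₁ : Integrable D₁ volume := (hu₁.integrable_mul hu₁).add (hu.integrable_mul hq)
  have iD₂ : Integrable D₂ volume := by
    refine (integrable_mul_mul_of_memLp (by fun_prop) √2 (fun z => ?_) hu hu).add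
      (integrable_mul_mul_of_memLp (by fun_prop) (2 * √2) (fun z => ?_) hu hu₁)
    · rw [abs_mul, abs_of_nonneg hr0]
      exact mul_le_of_le_one_right hr0 (abs_kinkSlope_le_one c z)
    · rw [abs_mul, abs_of_nonneg (by positivity)]
      exact mul_le_of_le_one_right (by positivity) (abs_kink_le_one c z)
  have zD₁ : ∫ z, D₁ z = 0 :=
    integral_eq_zero_of_hasDerivAt_of_integrable
      (fun z => (h.deriv_fst z).mul (h.deriv_snd z)) iD₁ (hu.integrable_mul hu₁)
  have zD₂ : ∫ z, D₂ z = 0 := by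
    refine integral_eq_zero_of_hasDerivAt_of_integrable (f := fun z => √2 * kink c z * (u z * u z))
      (fun z => ?_) iD₂ (integrable_mul_mul_of_memLp (by fun_prop) √2 (fun z => ?_) hu hu)
    · refine (((hasDerivAt_kink c z).const_mul √2).mul
        ((h.deriv_fst z).mul (h.deriv_fst z))).congr_deriv ?_
      simp only [D₂, Pi.mul_apply]; ring
    · rw [abs_mul, abs_of_nonneg hr0]
      exact mul_le_of_le_one_right hr0 (abs_kink_le_one c z)
  have iu := hu.integrable_sq
  have iu₁ := hu₁.integrable_sq
  have iw := h.memLp_w.integrable_sq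
  have k1 : ∫ z, μ ^ 2 * u z ^ 2 ≤ ∫ z, w z ^ 2 := by
    refine integral_le_of_le_add (D := fun z => 2 * μ * (D₁ z + D₂ z)) (iu.const_mul _) iw
      ((iD₁.add iD₂).const_mul _) ?_ fun z => ?_
    · rw [integral_const_mul, integral_add iD₁ iD₂, zD₁, zD₂]; simp
    · have e := sqrt_two_mul_kinkSlope c z
      -- Here w - μu = Lu and u₁ + √2 v u = Au.
      have key : w z ^ 2 + 2 * μ * (D₁ z + D₂ z) - μ ^ 2 * u z ^ 2 =
          (w z - μ * u z) ^ 2 + 2 * μ * (u₁ z + √2 * kink c z * u z) ^ 2 := by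
        simp only [D₁, D₂, hqdef, kinkPotential]
        linear_combination (2 * μ * u z ^ 2) * e - 2 * μ * kink c z ^ 2 * u z ^ 2 * r2
      have : 0 ≤ (w z - μ * u z) ^ 2 + 2 * μ * (u₁ z + √2 * kink c z * u z) ^ 2 := by positivity
      linarith
  -- Pair the equation with u, then use V ≥ -1 and uw ≤ (u² + w²)/2.
  have k2 : ∫ z, (μ * u z ^ 2 + u₁ z ^ 2) ≤ ∫ z, (3 / 2 * u z ^ 2 + 1 / 2 * w z ^ 2) := by
    refine integral_le_of_le_add ((iu.const_mul _).add iu₁) ((iu.const_mul _).add (iw.const_mul _))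
      iD₁ zD₁ fun z => ?_
    simp only [D₁, hqdef, kinkPotential]
    nlinarith [sq_nonneg (u z - w z), mul_nonneg (sq_nonneg (kink c z)) (sq_nonneg (u z))]
  rw [integral_add (iu.const_mul _) iu₁, integral_add (iu.const_mul _) (iw.const_mul _),
    integral_const_mul, integral_const_mul, integral_const_mul] at k2
  rw [integral_const_mul] at k1
  have n1 : 0 ≤ ∫ z, u z ^ 2 := integral_nonneg fun z => sq_nonneg _
  have n2 : 0 ≤ ∫ z, w z ^ 2 := integral_nonneg fun z => sq_nonneg _
  have h16 : 16 * (∫ z, u z ^ 2) ≤ ∫ z, w z ^ 2 :=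
    (mul_le_mul_of_nonneg_right (by nlinarith) n1).trans k1
  have h4 : 4 * (∫ z, w z ^ 2) ≤ μ * ∫ z, w z ^ 2 := mul_le_mul_of_nonneg_right hμ n2
  linarith

/-- The right-hand side is orthogonal to the kernel of the linearized operator. -/
theorem integral_kinkSlope_mul (h : IsResolventPair c 0 u u₁ w w₁) :
    ∫ z, kinkSlope c z * w z = 0 := by
  have hs := memLp_kinkSlope c
  have cv := continuous_kink c
  -- Because s' = -√2 v s, the function below is the Wronskian s'u - su₁, and its derivative is sw
  -- since Ls = 0.
  refine integral_eq_zero_of_hasDerivAt_of_integrable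
    (f := fun z => -(√2 * kink c z * kinkSlope c z) * u z - kinkSlope c z * u₁ z) (fun z => ?_)
    (hs.integrable_mul h.memLp_w) ?_
  · refine ((((((hasDerivAt_kink c z).const_mul √2).mul (hasDerivAt_kinkSlope c z)).neg).mul
      (h.deriv_fst z)).sub ((hasDerivAt_kinkSlope c z).mul (h.deriv_snd z))).congr_deriv ?_
    have e := sqrt_two_mul_kinkSlope c z
    have r2 : √2 ^ 2 = 2 := Real.sq_sqrt (by norm_num)
    simp only [kinkPotential, Pi.mul_apply, Pi.neg_apply]
    linear_combination (-kinkSlope c z * u z) * e + kink c z ^ 2 * kinkSlope c z * u z * r2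
  · have i1 := integrable_mul_mul_of_memLp (b := fun z => -(√2 * kink c z)) (by fun_prop) √2
      (fun z => by
        rw [abs_neg, abs_mul, abs_of_nonneg (Real.sqrt_nonneg 2)]
        nlinarith [abs_kink_le_one c z, Real.sqrt_nonneg 2]) hs h.memLp_u
    refine (i1.sub (hs.integrable_mul h.memLp_u₁)).congr (Eventually.of_forall fun z => ?_)
    simp; ring

/-- A weighted Poincaré inequality, using that the right-hand side has mean zero with respect to
the kink slope. -/
theorem integral_kinkSlope_mul_sq_le (h : IsResolventPair c 0 u u₁ w w₁) :
    ∫ z, kinkSlope c z * w z ^ 2 ≤ kinkMoment * ∫ z, w₁ z ^ 2 := by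
  have hs := memLp_kinkSlope c
  have cs := continuous_kinkSlope c
  have i1 := h.memLp_w₁.integrable_sq
  set N := ∫ z, w₁ z ^ 2 with hN
  -- Hölder continuity of exponent 1/2, by Cauchy–Schwarz on the interval between c and z.
  have hhol : ∀ z, (w z - w c) ^ 2 ≤ |z - c| * N := fun z => by
    rw [h.prim.2 c z]
    have hi : IntegrableOn w₁ (Set.uIoc c z) volume :=
      (LocallyIntegrable.intervalIntegrable' h.prim.1 c z).def'
    have hb : |∫ t in c..z, w₁ t| = |∫ t in Set.uIoc c z, w₁ t| := by
      rw [intervalIntegral.abs_integral_eq_abs_integral_uIoc]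
    have hm : volume.real (Set.uIoc c z) = |z - c| := by
      rw [measureReal_def, Real.volume_uIoc, ENNReal.toReal_ofReal (abs_nonneg _)]
    have hq : ∫ t in Set.uIoc c z, w₁ t ^ 2 ≤ N :=
      setIntegral_le_integral i1 (Eventually.of_forall fun t => sq_nonneg _)
    rw [← sq_abs, hb, sq_abs]
    set I := ∫ t in Set.uIoc c z, w₁ t with hI
    set J := ∫ t in Set.uIoc c z, w₁ t ^ 2
    rcases (abs_nonneg (z - c)).eq_or_lt with h0 | h0
    · have : z = c := by linarith [abs_eq_zero.1 h0.symm]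
      subst this
      simp [hI]
    -- Cauchy–Schwarz in the form that the variance of w₁ about its mean I/|z - c| is nonnegative.
    · have hpos : 0 ≤ ∫ t in Set.uIoc c z, (w₁ t - I / |z - c|) ^ 2 :=
        integral_nonneg fun t => sq_nonneg _
      have e : ∀ t, (w₁ t - I / |z - c|) ^ 2 =
          w₁ t ^ 2 - 2 * (I / |z - c|) * w₁ t + (I / |z - c|) ^ 2 := fun t => by ring
      have hfin : IsFiniteMeasure (volume.restrict (Set.uIoc c z)) :=
        ⟨by rw [Measure.restrict_apply_univ, Real.volume_uIoc]; exact ENNReal.ofReal_lt_top⟩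
      have hsub : IntegrableOn (fun t => w₁ t ^ 2 - 2 * (I / |z - c|) * w₁ t)
          (Set.uIoc c z) volume := i1.integrableOn.sub (hi.const_mul _)
      simp only [e] at hpos
      rw [integral_add hsub (integrable_const _),
        integral_sub i1.integrableOn (hi.const_mul _), integral_const_mul, setIntegral_const, hm,
        smul_eq_mul] at hpos
      have hJ : I ^ 2 ≤ |z - c| * J := by
        have e2 : J - 2 * (I / |z - c|) * I + |z - c| * (I / |z - c|) ^ 2 =
            (|z - c| * J - I ^ 2) / |z - c| := by field_simp; ring
        rw [e2, le_div_iff₀ h0] at hpos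
        linarith
      nlinarith
  have hsw : ∫ z, kinkSlope c z * w z = 0 := h.integral_kinkSlope_mul
  have isw : Integrable (fun z => kinkSlope c z * w z) volume := hs.integrable_mul h.memLp_w
  have isww : Integrable (fun z => kinkSlope c z * w z ^ 2) volume :=
    (integrable_mul_mul_of_memLp cs 1 (abs_kinkSlope_le_one c) h.memLp_w h.memLp_w).congr
      (Eventually.of_forall fun z => by simp [sq])
  rw [mul_comm, ← integral_kinkSlope_mul_abs c, ← integral_const_mul]
  -- Pointwise w² ≤ (w - w(c))² + 2w(c)w, and the last term has weighted integral zero by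
  -- orthogonality.
  refine integral_le_of_le_add (D := fun z => 2 * w c * (kinkSlope c z * w z)) isww
    ((integrable_kinkSlope_mul_abs c).const_mul _) (isw.const_mul _)
    (by rw [integral_const_mul, hsw, mul_zero]) fun z => ?_
  have h1 := hhol z
  have hp := kinkSlope_pos c z
  nlinarith [mul_le_mul_of_nonneg_left h1 hp.le, mul_nonneg hp.le (sq_nonneg (w c))]

theorem memLp_factor (h : IsResolventPair c 0 u u₁ w w₁) :
    MemLp (fun z => u₁ z + √2 * kink c z * u z) 2 volume := by
  have cv := continuous_kink c
  refine h.memLp_u₁.add (MemLp.bdd_mul_two (by fun_prop) √2 (fun z => ?_) h.memLp_u)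
  rw [abs_mul, abs_of_nonneg (Real.sqrt_nonneg 2)]
  exact mul_le_of_le_one_right (Real.sqrt_nonneg 2) (abs_kink_le_one c z)

/-- For g = Au this is the first-order equation A*g = w. -/
theorem hasDerivAt_factor (h : IsResolventPair c 0 u u₁ w w₁) (z : ℝ) :
    HasDerivAt (fun z => u₁ z + √2 * kink c z * u z)
      (√2 * kink c z * (u₁ z + √2 * kink c z * u z) - w z) z := by
  refine ((h.deriv_snd z).add ((((hasDerivAt_kink c z).const_mul √2)).mul
    (h.deriv_fst z))).congr_deriv ?_
  have e := sqrt_two_mul_kinkSlope c z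
  have r2 : √2 ^ 2 = 2 := Real.sq_sqrt (by norm_num)
  simp only [kinkPotential]
  linear_combination u z * e - kink c z ^ 2 * u z * r2

/-- Test A*g = w with vsg: integrating the derivative of vsg² gives ∫s(1 + v²)g² = 2√2∫svgw, and 2√2
vgw ≤ v²g² + 2w² absorbs the v² part. -/
theorem integral_kinkSlope_mul_factor_sq_le (h : IsResolventPair c 0 u u₁ w w₁) :
    ∫ z, kinkSlope c z * (u₁ z + √2 * kink c z * u z) ^ 2 ≤
      2 * ∫ z, kinkSlope c z * w z ^ 2 := by
  have cv := continuous_kink c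
  have cs := continuous_kinkSlope c
  have hg := h.memLp_factor
  have hg' := h.hasDerivAt_factor
  have hw := h.memLp_w
  set g : ℝ → ℝ := fun z => u₁ z + √2 * kink c z * u z with hgdef
  have hr0 := Real.sqrt_nonneg 2
  have r2 : √2 ^ 2 = 2 := Real.sq_sqrt (by norm_num)
  have bv : ∀ z, |kink c z * kinkSlope c z| ≤ 1 := fun z => by
    rw [abs_mul]
    exact mul_le_one₀ (abs_kink_le_one c z) (abs_nonneg _) (abs_kinkSlope_le_one c z)
  let D : ℝ → ℝ := fun z =>
    (kinkSlope c z + √2 * kink c z ^ 2) * kinkSlope c z * (g z * g z) +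
      -2 * (kink c z * kinkSlope c z * (g z * w z))
  have iD : Integrable D volume := by
    refine (integrable_mul_mul_of_memLp (by fun_prop) (1 + √2) (fun z => ?_) hg hg).add
      ((integrable_mul_mul_of_memLp (by fun_prop) 1 bv hg hw).const_mul _)
    have h1 := kinkSlope_pos c z
    rw [abs_of_nonneg (by positivity)]
    have h2 : kinkSlope c z + √2 * kink c z ^ 2 ≤ 1 + √2 := by
      nlinarith [kinkSlope_le_one c z, kink_sq_lt_one c z]
    nlinarith [kinkSlope_le_one c z, mul_nonneg hr0 (sq_nonneg (kink c z))]
  have zD : ∫ z, D z = 0 := by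
    refine integral_eq_zero_of_hasDerivAt_of_integrable
      (f := fun z => kink c z * kinkSlope c z * (g z * g z)) (fun z => ?_) iD
      (integrable_mul_mul_of_memLp (by fun_prop) 1 bv hg hg)
    refine (((hasDerivAt_kink c z).mul (hasDerivAt_kinkSlope c z)).mul
      ((hg' z).mul (hg' z))).congr_deriv ?_
    simp only [D, Pi.mul_apply]
    ring
  have isgg : Integrable (fun z => kinkSlope c z * g z ^ 2) volume :=
    (integrable_mul_mul_of_memLp cs 1 (abs_kinkSlope_le_one c) hg hg).congr
      (Eventually.of_forall fun z => by simp [sq])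
  have isww : Integrable (fun z => kinkSlope c z * w z ^ 2) volume :=
    (integrable_mul_mul_of_memLp cs 1 (abs_kinkSlope_le_one c) hw hw).congr
      (Eventually.of_forall fun z => by simp [sq])
  rw [← integral_const_mul]
  refine integral_le_of_le_add (D := fun z => √2 * D z) isgg (isww.const_mul _) (iD.const_mul _)
    (by rw [integral_const_mul, zD, mul_zero]) fun z => ?_
  have e := sqrt_two_mul_kinkSlope c z
  have key : 2 * (kinkSlope c z * w z ^ 2) + √2 * D z - kinkSlope c z * g z ^ 2 =
      kinkSlope c z * (√2 * w z - kink c z * g z) ^ 2 := by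
    simp only [D]
    linear_combination (kinkSlope c z * g z ^ 2) * e +
      (kink c z ^ 2 * kinkSlope c z * g z ^ 2 - kinkSlope c z * w z ^ 2) * r2
  have : 0 ≤ kinkSlope c z * (√2 * w z - kink c z * g z) ^ 2 :=
    mul_nonneg (kinkSlope_pos c z).le (sq_nonneg _)
  linarith

end IsResolventPair
-- The embedding of H¹ into bounded functions: (u²)' = 2uu₁ is integrable.
theorem exists_bound_of_memLp_deriv {u u₁ : ℝ → ℝ} (hu : ∀ z, HasDerivAt u (u₁ z) z)
    (hc : Continuous u₁) (h : MemLp u 2 volume) (h₁ : MemLp u₁ 2 volume) :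
    ∃ M, 0 ≤ M ∧ ∀ z, |u z| ≤ M := by
  have hcu : Continuous u := continuous_iff_continuousAt.2 fun z => (hu z).continuousAt
  have i : Integrable (fun z => u₁ z * u z + u z * u₁ z) volume :=
    (h₁.integrable_mul h).add (h.integrable_mul h₁)
  refine ⟨√(u 0 * u 0 + ∫ z, |u₁ z * u z + u z * u₁ z|), Real.sqrt_nonneg _, fun z => ?_⟩
  refine Real.abs_le_sqrt ?_
  have e := intervalIntegral.integral_eq_sub_of_hasDerivAt (a := 0) (b := z)
    (fun x _ => (hu x).mul (hu x))
    (((hc.mul hcu).add (hcu.mul hc)).intervalIntegrable _ _)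
  have h1 : |∫ x in (0 : ℝ)..z, (u₁ x * u x + u x * u₁ x)| ≤ ∫ z, |u₁ z * u z + u z * u₁ z| := by
    rw [← Real.norm_eq_abs]
    refine (intervalIntegral.norm_integral_le_integral_norm_uIoc).trans ?_
    exact setIntegral_le_integral i.norm (Eventually.of_forall fun t => norm_nonneg _)
  rw [e] at h1
  have := (abs_le.1 h1).2
  simp only [Pi.mul_apply] at this
  nlinarith

namespace IsResolventPair

variable {c μ : ℝ} {u u₁ w w₁ : ℝ → ℝ}

/-- If `u` is orthogonal to the kink slope, then the equation `-R' + √2 v_c R = -u` has a bounded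
solution. -/
theorem exists_bounded_dual (h : IsResolventPair c 0 u u₁ w w₁)
    (h0 : ∫ z, kinkSlope c z * u z = 0) :
    ∃ (R : ℝ → ℝ) (B : ℝ), (∀ z, HasDerivAt R (u z + √2 * kink c z * R z) z) ∧ ∀ z, |R z| ≤ B := by
  obtain ⟨M, hM0, hM⟩ := exists_bound_of_memLp_deriv h.deriv_fst h.continuous_u₁ h.memLp_u h.memLp_u₁
  have cs := continuous_kinkSlope c
  have cu := h.continuous_u
  have is := integrable_kinkSlope c
  have hint : Integrable (fun z => kinkSlope c z * u z) volume :=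
    (memLp_kinkSlope c).integrable_mul h.memLp_u
  have hptw : ∀ z, ‖kinkSlope c z * u z‖ ≤ M * kinkSlope c z := fun z => by
    rw [norm_mul, Real.norm_eq_abs, Real.norm_eq_abs, abs_of_pos (kinkSlope_pos c z), mul_comm]
    exact mul_le_mul_of_nonneg_right (hM z) (kinkSlope_pos c z).le
  let P : ℝ → ℝ := fun z => ∫ t in Set.Iic z, kinkSlope c t * u t
  have hP : ∀ z, HasDerivAt P (kinkSlope c z * u z) z := fun z => by
    have e : P = fun z => (∫ t in Set.Iic (0 : ℝ), kinkSlope c t * u t) +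
        ∫ t in (0 : ℝ)..z, kinkSlope c t * u t := by
      funext z
      rw [← intervalIntegral.integral_Iic_sub_Iic hint.integrableOn hint.integrableOn]
      ring
    rw [e]
    have hcont : Continuous fun t => kinkSlope c t * u t := cs.mul cu
    exact (intervalIntegral.integral_hasDerivAt_right (hcont.intervalIntegrable _ _)
      (hcont.stronglyMeasurableAtFilter _ _) hcont.continuousAt).const_add _
  have b1 : ∀ z, |P z| ≤ M * (1 + kink c z) := fun z => by
    refine (Real.norm_eq_abs _).symm.trans_le ((norm_integral_le_integral_norm _).trans ?_)
    refine (integral_mono hint.norm.integrableOn (is.integrableOn.const_mul M) hptw).trans ?_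
    rw [integral_const_mul]
    exact mul_le_mul_of_nonneg_left (integral_Iic_kinkSlope_le c z) hM0
  -- Orthogonality enters here: P is also minus the integral over the right tail, so it is small at
  -- both ends.
  have b2 : ∀ z, |P z| ≤ M * (1 - kink c z) := fun z => by
    have e : P z = - ∫ t in Set.Ioi z, kinkSlope c t * u t := by
      have := intervalIntegral.integral_Iic_add_Ioi (b := z) hint.integrableOn hint.integrableOn
      rw [h0] at this
      simp only [P]; linarith
    rw [e, abs_neg]
    refine (Real.norm_eq_abs _).symm.trans_le ((norm_integral_le_integral_norm _).trans ?_)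
    refine (integral_mono hint.norm.integrableOn (is.integrableOn.const_mul M) hptw).trans ?_
    rw [integral_const_mul]
    exact mul_le_mul_of_nonneg_left (integral_Ioi_kinkSlope_le c z) hM0
  -- From s' = -√2 v s, the quotient R = P/s solves R' = u + √2 v R.
  refine ⟨fun z => P z / kinkSlope c z, M * √2, fun z => ?_, fun z => ?_⟩
  · have hs := (kinkSlope_pos c z).ne'
    refine ((hP z).div (hasDerivAt_kinkSlope c z) hs).congr_deriv ?_
    field_simp
    ring
  · have hs := kinkSlope_pos c z
    rw [abs_div, abs_of_pos hs, div_le_iff₀ hs, mul_assoc, sqrt_two_mul_kinkSlope]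
    have hv := abs_le.1 (abs_kink_le_one c z)
    -- √2 s = (1 - v)(1 + v), and one of the factors is at least 1; the sign of v decides which tail
    -- bound to use.
    rcases le_total 0 (kink c z) with hk | hk
    · refine (b2 z).trans (mul_le_mul_of_nonneg_left ?_ hM0)
      nlinarith
    · refine (b1 z).trans (mul_le_mul_of_nonneg_left ?_ hM0)
      nlinarith

/-- A duality argument with the bounded R satisfying A*R = -u. Integrating (Rsu)' gives ∫su² =
-∫sRu₁, and integrating (vR²s)' evaluates the term ∫svRu that arises from u₁ = g - √2 v u with g =
Au. The result is ∫su² = -∫sRg - ½∫s(1 + v²)R² ≤ ½∫sg². -/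
theorem integral_kinkSlope_mul_sq_le_factor (h : IsResolventPair c 0 u u₁ w w₁)
    (h0 : ∫ z, kinkSlope c z * u z = 0) :
    ∫ z, kinkSlope c z * u z ^ 2 ≤
      1 / 2 * ∫ z, kinkSlope c z * (u₁ z + √2 * kink c z * u z) ^ 2 := by
  obtain ⟨R, B, hR, hB⟩ := h.exists_bounded_dual h0
  have cv := continuous_kink c
  have cs := continuous_kinkSlope c
  have cR : Continuous R := continuous_iff_continuousAt.2 fun z => (hR z).continuousAt
  have hs := memLp_kinkSlope c
  have hu := h.memLp_u
  have hu₁ := h.memLp_u₁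
  have hg := h.memLp_factor
  have hr0 := Real.sqrt_nonneg 2
  have r2 : √2 ^ 2 = 2 := Real.sq_sqrt (by norm_num)
  have isuu : Integrable (fun z => kinkSlope c z * (u z * u z)) volume :=
    integrable_mul_mul_of_memLp cs 1 (abs_kinkSlope_le_one c) hu hu
  have iRsu : Integrable (fun z => R z * (kinkSlope c z * u z)) volume :=
    integrable_mul_mul_of_memLp cR B hB hs hu
  have iRsu₁ : Integrable (fun z => R z * (kinkSlope c z * u₁ z)) volume :=
    integrable_mul_mul_of_memLp cR B hB hs hu₁
  have hB0 : 0 ≤ B := (abs_nonneg _).trans (hB 0)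
  have bvR : ∀ z, |kink c z * R z| ≤ B := fun z => by
    rw [abs_mul]
    exact (mul_le_of_le_one_left (abs_nonneg _) (abs_kink_le_one c z)).trans (hB z)
  have ivRsu : Integrable (fun z => kink c z * R z * (kinkSlope c z * u z)) volume :=
    integrable_mul_mul_of_memLp (cv.mul cR) B bvR hs hu
  have isRR : ∀ b : ℝ → ℝ, Continuous b → (∀ z, |b z| ≤ 1) →
      Integrable (fun z => b z * R z ^ 2 * kinkSlope c z) volume := fun b hb hb1 => by
    refine (integrable_kinkSlope c).bdd_mul (c := B ^ 2) (by fun_prop)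
      (Eventually.of_forall fun z => ?_)
    rw [Real.norm_eq_abs, abs_mul, abs_pow]
    exact (mul_le_of_le_one_left (by positivity) (hb1 z)).trans
      (pow_le_pow_left₀ (abs_nonneg _) (hB z) 2)
  have bs : ∀ z, |kink c z ^ 2| ≤ 1 := fun z => by
    rw [abs_of_nonneg (sq_nonneg _)]; exact (kink_sq_lt_one c z).le
  let D₁ : ℝ → ℝ := fun z =>
    kinkSlope c z * (u z * u z) + R z * (kinkSlope c z * u₁ z)
  let D₂ : ℝ → ℝ := fun z => kinkSlope c z * R z ^ 2 * kinkSlope c z +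
    √2 * (kink c z ^ 2 * R z ^ 2 * kinkSlope c z) + 2 * (kink c z * R z * (kinkSlope c z * u z))
  have iD₁ : Integrable D₁ volume := isuu.add iRsu₁
  have iD₂ : Integrable D₂ volume :=
    ((isRR _ cs (abs_kinkSlope_le_one c)).add ((isRR _ (cv.pow 2) bs).const_mul _)).add
      (ivRsu.const_mul _)
  have zD₁ : ∫ z, D₁ z = 0 := by
    refine integral_eq_zero_of_hasDerivAt_of_integrable
      (f := fun z => R z * (kinkSlope c z * u z)) (fun z => ?_) iD₁ iRsu
    refine ((hR z).mul ((hasDerivAt_kinkSlope c z).mul (h.deriv_fst z))).congr_deriv ?_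
    simp only [D₁, Pi.mul_apply]
    ring
  have zD₂ : ∫ z, D₂ z = 0 := by
    refine integral_eq_zero_of_hasDerivAt_of_integrable
      (f := fun z => kink c z * R z ^ 2 * kinkSlope c z) (fun z => ?_) iD₂
      (isRR _ cv (abs_kink_le_one c))
    refine (((hasDerivAt_kink c z).mul ((hR z).pow 2)).mul
      (hasDerivAt_kinkSlope c z)).congr_deriv ?_
    simp only [D₂, Pi.mul_apply, Pi.pow_apply]
    push_cast
    ring
  have isu : Integrable (fun z => kinkSlope c z * u z ^ 2) volume :=
    isuu.congr (Eventually.of_forall fun z => by simp [sq])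
  have isg : Integrable (fun z => kinkSlope c z * (u₁ z + √2 * kink c z * u z) ^ 2) volume :=
    (integrable_mul_mul_of_memLp cs 1 (abs_kinkSlope_le_one c) hg hg).congr
      (Eventually.of_forall fun z => by simp [sq])
  rw [← integral_const_mul]
  refine integral_le_of_le_add (D := fun z => D₁ z + √2 / 2 * D₂ z) isu (isg.const_mul _)
    (iD₁.add (iD₂.const_mul _))
    (by rw [integral_add iD₁ (iD₂.const_mul _), integral_const_mul, zD₁, zD₂]; simp) fun z => ?_
  have e := sqrt_two_mul_kinkSlope c z
  have hp := kinkSlope_pos c z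
  have key : 1 / 2 * (kinkSlope c z * (u₁ z + √2 * kink c z * u z) ^ 2) +
      (D₁ z + √2 / 2 * D₂ z) - kinkSlope c z * u z ^ 2 =
      1 / 2 * kinkSlope c z * (u₁ z + √2 * kink c z * u z + R z) ^ 2 +
        1 / 2 * kinkSlope c z * (kink c z * R z) ^ 2 := by
    simp only [D₁, D₂]
    linear_combination (R z ^ 2 * kinkSlope c z / 2) * e +
      (kink c z ^ 2 * R z ^ 2 * kinkSlope c z / 2) * r2
  have : 0 ≤ 1 / 2 * kinkSlope c z * (u₁ z + √2 * kink c z * u z + R z) ^ 2 +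
        1 / 2 * kinkSlope c z * (kink c z * R z) ^ 2 := by positivity
  linarith

/-- Testing the equation with q = u'' gives ∫(q² + Vu₁² + 6vs uu₁) = ∫u₁w₁. The potential is below 2
only by a multiple of s, and the mixed term also carries the weight s, so the previous weighted
estimates close the argument. -/
theorem integral_sq_deriv_le (h : IsResolventPair c 0 u u₁ w w₁)
    (h0 : ∫ z, kinkSlope c z * u z = 0) :
    ∫ z, u₁ z ^ 2 ≤ (1 + 50 * kinkMoment) * ∫ z, w₁ z ^ 2 := by
  have cv := continuous_kink c
  have cs := continuous_kinkSlope c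
  have cV := continuous_kinkPotential c
  have hu := h.memLp_u
  have hu₁ := h.memLp_u₁
  have hw := h.memLp_w
  have hw₁ := h.memLp_w₁
  have hg := h.memLp_factor
  have hq := h.memLp_snd
  have e1 := h.integral_kinkSlope_mul_sq_le
  have e2 := h.integral_kinkSlope_mul_factor_sq_le
  have e3 := h.integral_kinkSlope_mul_sq_le_factor h0
  have r2 : √2 ^ 2 = 2 := Real.sq_sqrt (by norm_num)
  have hsq : ∀ {f : ℝ → ℝ}, MemLp f 2 volume → Integrable (fun z => kinkSlope c z * f z ^ 2) volume :=
    fun hf => (integrable_mul_mul_of_memLp cs 1 (abs_kinkSlope_le_one c) hf hf).congr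
      (Eventually.of_forall fun z => by simp [sq])
  have e4 : ∫ z, kinkSlope c z * u₁ z ^ 2 ≤
      ∫ z, (2 * (kinkSlope c z * (u₁ z + √2 * kink c z * u z) ^ 2) +
        4 * (kinkSlope c z * u z ^ 2)) := by
    refine integral_mono (hsq hu₁) (((hsq hg).const_mul _).add ((hsq hu).const_mul _)) fun z => ?_
    have hp := kinkSlope_pos c z
    have hk := kink_sq_lt_one c z
    have h1 : u₁ z ^ 2 ≤ 2 * (u₁ z + √2 * kink c z * u z) ^ 2 + 4 * u z ^ 2 := by
      have h2 : (√2 * kink c z * u z) ^ 2 ≤ 2 * u z ^ 2 := by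
        rw [mul_pow, mul_pow, r2]
        nlinarith [sq_nonneg (u z)]
      nlinarith [sq_nonneg (u₁ z + 2 * (√2 * kink c z * u z))]
    have := mul_le_mul_of_nonneg_left h1 hp.le
    linarith
  rw [integral_add ((hsq hg).const_mul _) ((hsq hu).const_mul _), integral_const_mul,
    integral_const_mul] at e4
  set q : ℝ → ℝ := fun z => (kinkPotential c z + 0) * u z - w z with hqdef
  -- `D₁` and `D₂` are the derivatives of Vuu₁ and u₁w, the latter almost everywhere.
  let D₁ : ℝ → ℝ := fun z => 6 * (kink c z * kinkSlope c z * (u z * u₁ z)) +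
    kinkPotential c z * (u₁ z * u₁ z) + kinkPotential c z * (u z * q z)
  let D₂ : ℝ → ℝ := fun z => q z * w z + u₁ z * w₁ z
  have bv : ∀ z, |kink c z * kinkSlope c z| ≤ 1 := fun z => by
    rw [abs_mul]
    exact mul_le_one₀ (abs_kink_le_one c z) (abs_nonneg _) (abs_kinkSlope_le_one c z)
  have iD₁ : Integrable D₁ volume :=
    (((integrable_mul_mul_of_memLp (cv.mul cs) 1 bv hu hu₁).const_mul 6).add
      (integrable_mul_mul_of_memLp cV 2 (abs_kinkPotential_le c) hu₁ hu₁)).add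
      (integrable_mul_mul_of_memLp cV 2 (abs_kinkPotential_le c) hu hq)
  have iD₂ : Integrable D₂ volume := (hq.integrable_mul hw).add (hu₁.integrable_mul hw₁)
  have zD₁ : ∫ z, D₁ z = 0 := by
    refine integral_eq_zero_of_hasDerivAt_of_integrable
      (f := fun z => kinkPotential c z * (u z * u₁ z)) (fun z => ?_) iD₁
      (integrable_mul_mul_of_memLp cV 2 (abs_kinkPotential_le c) hu hu₁)
    refine ((hasDerivAt_kinkPotential c z).mul
      ((h.deriv_fst z).mul (h.deriv_snd z))).congr_deriv ?_
    simp only [D₁, Pi.mul_apply, hqdef]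
    ring
  have cq : Continuous q :=
    ((cV.add continuous_const).mul h.continuous_u).sub h.prim.continuous
  have zD₂ : ∫ z, D₂ z = 0 :=
    ((IsPrimitive.of_hasDerivAt h.deriv_snd cq).mul h.prim).integral_eq_zero
      (hu₁.integrable_mul hw) iD₂
  have iu₁ := hu₁.integrable_sq
  have iw₁ := hw₁.integrable_sq
  have e5 : ∫ z, 3 / 2 * u₁ z ^ 2 ≤ ∫ z, (9 * (kinkSlope c z * u₁ z ^ 2) +
      3 * (kinkSlope c z * u z ^ 2) + 1 / 2 * w₁ z ^ 2) := by
    refine integral_le_of_le_add (D := fun z => D₁ z - D₂ z) (iu₁.const_mul _)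
      ((((hsq hu₁).const_mul _).add ((hsq hu).const_mul _)).add (iw₁.const_mul _))
      (iD₁.sub iD₂) (by rw [integral_sub iD₁ iD₂, zD₁, zD₂, sub_zero]) fun z => ?_
    have e := sqrt_two_mul_kinkSlope c z
    have hp := kinkSlope_pos c z
    have hs2 : √2 ≤ 2 := Real.sqrt_le_iff.2 ⟨by norm_num, by norm_num⟩
    -- V = 2 - 3√2 s ≥ 2 - 6s.
    have hV : 2 * u₁ z ^ 2 ≤ kinkPotential c z * u₁ z ^ 2 + 6 * (kinkSlope c z * u₁ z ^ 2) := by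
      have : 2 ≤ kinkPotential c z + 6 * kinkSlope c z := by
        rw [kinkPotential]; nlinarith
      nlinarith [mul_le_mul_of_nonneg_right this (sq_nonneg (u₁ z))]
    have hmix : 0 ≤ 6 * (kink c z * kinkSlope c z * (u z * u₁ z)) +
        3 * (kinkSlope c z * u₁ z ^ 2) + 3 * (kinkSlope c z * u z ^ 2) := by
      have hk := kink_sq_lt_one c z
      have : 0 ≤ 3 * kinkSlope c z * ((u z + kink c z * u₁ z) ^ 2 +
        (1 - kink c z ^ 2) * u₁ z ^ 2) :=
        mul_nonneg (by positivity) (add_nonneg (sq_nonneg _)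
          (mul_nonneg (by linarith) (sq_nonneg _)))
      nlinarith
    have hD : D₁ z - D₂ z = 6 * (kink c z * kinkSlope c z * (u z * u₁ z)) +
        kinkPotential c z * u₁ z ^ 2 + q z ^ 2 - u₁ z * w₁ z := by
      simp only [D₁, D₂, hqdef]; ring
    rw [hD]
    nlinarith [sq_nonneg (u₁ z - w₁ z), sq_nonneg (q z)]
  have i5 : Integrable (fun z => 9 * (kinkSlope c z * u₁ z ^ 2) +
      3 * (kinkSlope c z * u z ^ 2)) volume := ((hsq hu₁).const_mul _).add ((hsq hu).const_mul _)
  rw [integral_add i5 (iw₁.const_mul _),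
    integral_add ((hsq hu₁).const_mul _) ((hsq hu).const_mul _), integral_const_mul,
    integral_const_mul, integral_const_mul, integral_const_mul] at e5
  have n1 : 0 ≤ ∫ z, w₁ z ^ 2 := integral_nonneg fun z => sq_nonneg _
  -- With m the moment and N = ∫w₁², the weighted bounds are ∫su² ≤ mN and ∫su₁² ≤ 8mN. Hence
  -- (3/2)∫u₁² ≤ (9·8 + 3)mN + N/2, and 75·2/3 = 50.
  linarith

end IsResolventPair
-- The estimate for a single mode, for weak solutions.
theorem HasWeakDerivReal.congr {u u₁ v v₁ : ℝ → ℝ} (h : HasWeakDerivReal u u₁)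
    (e : u =ᵐ[volume] v) (e₁ : u₁ =ᵐ[volume] v₁) : HasWeakDerivReal v v₁ := fun η hη hc => by
  have h1 : ∫ z, v z * deriv η z = ∫ z, u z * deriv η z :=
    integral_congr_ae (by filter_upwards [e] with z hz; rw [hz])
  have h2 : ∫ z, v₁ z * η z = ∫ z, u₁ z * η z :=
    integral_congr_ae (by filter_upwards [e₁] with z hz; rw [hz])
  rw [h1, h2, h η hη hc]

theorem MemLp.locallyIntegrable_two {α : Type*} [MeasurableSpace α] [TopologicalSpace α]
    {μ : Measure α} [IsLocallyFiniteMeasure μ] {u : α → ℝ} (h : MemLp u 2 μ) :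
    LocallyIntegrable u μ := h.locallyIntegrable (by norm_num)

/-- The constant in the one-dimensional dissipation estimate. -/
noncomputable def dissipationConst : ℝ := 1 + 50 * kinkMoment

theorem one_le_dissipationConst : 1 ≤ dissipationConst := by
  have := kinkMoment_nonneg
  rw [dissipationConst]; linarith

/-- The dissipation estimate for a single Fourier mode, for weak solutions. -/
theorem mode_estimate {c μ : ℝ} {u u₁ w w₁ : ℝ → ℝ} (hu : MemLp u 2 volume)
    (hu₁ : MemLp u₁ 2 volume) (hw : MemLp w 2 volume) (hw₁ : MemLp w₁ 2 volume)
    (d₁ : HasWeakDerivReal u u₁)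
    (d₂ : HasWeakDerivReal u₁ (fun z => (kinkPotential c z + μ) * u z - w z))
    (d₃ : HasWeakDerivReal w w₁)
    (hμ : (μ = 0 ∧ ∫ z, kinkSlope c z * u z = 0) ∨ 4 ≤ μ) :
    μ * (∫ z, u z ^ 2) + (∫ z, u₁ z ^ 2) ≤
      dissipationConst * (μ * (∫ z, w z ^ 2) + (∫ z, w₁ z ^ 2)) := by
  have cV : Continuous fun z => kinkPotential c z + μ :=
    (continuous_kinkPotential c).add continuous_const
  obtain ⟨W, hW, eW⟩ := d₃.exists_isPrimitive (MemLp.locallyIntegrable_two hw)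
    (MemLp.locallyIntegrable_two hw₁)
  have hq : MemLp (fun z => (kinkPotential c z + μ) * u z - w z) 2 volume :=
    (MemLp.bdd_mul_two cV (2 + |μ|)
      (fun z => (abs_add_le _ _).trans (by linarith [abs_kinkPotential_le c z])) hu).sub hw
  obtain ⟨U₁, hU₁, eU₁⟩ := d₂.exists_isPrimitive (MemLp.locallyIntegrable_two hu₁)
    (MemLp.locallyIntegrable_two hq)
  obtain ⟨U, hU, eU⟩ := (d₁.congr (ae_eq_refl u) eU₁.symm).exists_isPrimitive
    (MemLp.locallyIntegrable_two hu) hU₁.continuous.locallyIntegrable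
  have cQ : Continuous fun z => (kinkPotential c z + μ) * U z - W z :=
    (cV.mul hU.continuous).sub hW.continuous
  -- With the continuous representatives inserted, the right-hand side is continuous, so U is a
  -- classical C² solution.
  have hU₁' : IsPrimitive U₁ (fun z => (kinkPotential c z + μ) * U z - W z) := by
    refine ⟨cQ.locallyIntegrable, fun a b => ?_⟩
    rw [hU₁.2 a b]
    refine intervalIntegral.integral_congr_ae ?_
    filter_upwards [eU, eW] with z h1 h2 _
    rw [h1, h2]
  have H : IsResolventPair c μ U U₁ W w₁ :=
    { deriv_fst := fun z => hU.hasDerivAt hU₁.continuous z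
      deriv_snd := fun z => hU₁'.hasDerivAt cQ z
      prim := hW
      memLp_u := hu.ae_eq eU.symm
      memLp_u₁ := hu₁.ae_eq eU₁.symm
      memLp_w := hw.ae_eq eW.symm
      memLp_w₁ := hw₁ }
  have E1 : ∫ z, u z ^ 2 = ∫ z, U z ^ 2 :=
    integral_congr_ae (by filter_upwards [eU] with z hz; rw [hz])
  have E2 : ∫ z, u₁ z ^ 2 = ∫ z, U₁ z ^ 2 :=
    integral_congr_ae (by filter_upwards [eU₁] with z hz; rw [hz])
  have E3 : ∫ z, w z ^ 2 = ∫ z, W z ^ 2 :=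
    integral_congr_ae (by filter_upwards [eW] with z hz; rw [hz])
  have n1 : 0 ≤ ∫ z, W z ^ 2 := integral_nonneg fun z => sq_nonneg _
  have n2 : 0 ≤ ∫ z, w₁ z ^ 2 := integral_nonneg fun z => sq_nonneg _
  rw [E1, E2, E3]
  rcases hμ with ⟨rfl, h0⟩ | h4
  · have h0' : ∫ z, kinkSlope c z * U z = 0 := by
      rw [← h0]
      exact integral_congr_ae (by filter_upwards [eU] with z hz; rw [hz])
    simpa [dissipationConst] using H.integral_sq_deriv_le h0'
  · have h1 := H.integral_sq_le_of_four_le h4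
    -- For nonzero frequencies the constant 1 already suffices, and the w₁ term is only added.
    have h2 := one_le_dissipationConst
    have h3 : 0 ≤ μ * ∫ z, W z ^ 2 := mul_nonneg (by linarith) n1
    nlinarith [mul_nonneg (sub_nonneg.2 h2) h3, mul_nonneg (by linarith : 0 ≤ dissipationConst) n2]

/-! ### Fourier coefficients in the torus variable and Parseval on the strip. -/

/-- The pairing of a function on the strip with a function on the torus, slice by slice. -/
noncomputable def torusCoeff {n : ℕ} (ψ : (Fin n → UnitAddCircle) → ℝ) (h : Strip n → ℝ)
    (z : ℝ) : ℝ := ∫ x, ψ x * h (x, z)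

variable {n : ℕ}

theorem exists_bound_of_continuous_torus {ψ : (Fin n → UnitAddCircle) → ℝ} (hψ : Continuous ψ) :
    ∃ C, ∀ x, ‖ψ x‖ ≤ C := by
  obtain ⟨C, hC⟩ := isCompact_univ.exists_bound_of_continuousOn hψ.continuousOn
  exact ⟨C, fun x => hC x trivial⟩

theorem LocallyIntegrable.integrableOn_slab {h : Strip n → ℝ} (hh : LocallyIntegrable h volume)
    {K : Set ℝ} (hK : IsCompact K) :
    Integrable h ((volume : Measure (Fin n → UnitAddCircle)).prod (volume.restrict K)) := by
  have := hh.integrableOn_isCompact (isCompact_univ.prod hK)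
  rwa [IntegrableOn, Measure.volume_eq_prod, ← Measure.prod_restrict, Measure.restrict_univ] at this

theorem LocallyIntegrable.torusCoeff {h : Strip n → ℝ} (hh : LocallyIntegrable h volume)
    {ψ : (Fin n → UnitAddCircle) → ℝ} (hψ : Continuous ψ) :
    LocallyIntegrable (torusCoeff ψ h) volume := by
  obtain ⟨C, hC⟩ := exists_bound_of_continuous_torus hψ
  rw [locallyIntegrable_iff]
  intro K hK
  have h1 := LocallyIntegrable.integrableOn_slab hh hK
  have h2 := h1.bdd_mul (f := fun p : Strip n => ψ p.1) (c := C)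
    (hψ.comp continuous_fst).aestronglyMeasurable (Eventually.of_forall fun p => hC p.1)
  exact h2.integral_prod_right

theorem LocallyIntegrable.ae_integrable_slice {h : Strip n → ℝ} (hh : LocallyIntegrable h volume) :
    ∀ᵐ z : ℝ, Integrable (fun x => h (x, z)) volume := by
  have : ∀ m : ℕ, ∀ᵐ z : ℝ, z ∈ Set.Icc (-(m : ℝ)) m → Integrable (fun x => h (x, z)) volume :=
    fun m => (ae_restrict_iff' measurableSet_Icc).1
      (LocallyIntegrable.integrableOn_slab hh isCompact_Icc).prod_left_ae
  filter_upwards [ae_all_iff.2 this] with z hz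
  obtain ⟨m, hm⟩ := exists_nat_ge |z|
  exact hz m (abs_le.1 hm)

theorem hasCompactSupport_torus_mul {η : ℝ → ℝ} (hη : HasCompactSupport η)
    (ψ : (Fin n → UnitAddCircle) → ℝ) :
    HasCompactSupport (fun p : Strip n => ψ p.1 * η p.2) := by
  refine HasCompactSupport.of_support_subset_isCompact (isCompact_univ.prod hη.isCompact)
    fun p hp => ⟨trivial, subset_tsupport _ fun h0 => hp ?_⟩
  simp [h0]

theorem LocallyIntegrable.integral_mul_torus_mul {h : Strip n → ℝ}
    (hh : LocallyIntegrable h volume) {ψ : (Fin n → UnitAddCircle) → ℝ} (hψ : Continuous ψ)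
    {η : ℝ → ℝ} (hη : Continuous η) (hc : HasCompactSupport η) :
    ∫ p, h p * (ψ p.1 * η p.2) = ∫ z, CahnHilliard.torusCoeff ψ h z * η z := by
  have hi : Integrable (fun p => h p * (ψ p.1 * η p.2)) volume := by
    have := hh.integrable_smul_left_of_hasCompactSupport
      ((hψ.comp continuous_fst).mul (hη.comp continuous_snd)) (hasCompactSupport_torus_mul hc ψ)
    simpa [mul_comm] using this
  rw [Measure.volume_eq_prod] at hi ⊢
  rw [integral_prod_symm _ hi]
  refine integral_congr_ae (Eventually.of_forall fun z => ?_)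
  simp only [CahnHilliard.torusCoeff]
  rw [← integral_mul_const]
  refine integral_congr_ae (Eventually.of_forall fun x => ?_)
  simp only; ring

theorem MemLp.ae_slice {h : Strip n → ℝ} (hh : MemLp h 2 volume) :
    ∀ᵐ z : ℝ, MemLp (fun x => h (x, z)) 2 volume := by
  have h1 : ∀ᵐ z : ℝ, Integrable (fun x => h (x, z) ^ 2) volume :=
    Integrable.prod_left_ae (f := fun p : Strip n => h p ^ 2) hh.integrable_sq
  filter_upwards [h1, LocallyIntegrable.ae_integrable_slice (MemLp.locallyIntegrable_two hh)]
    with z h2 h3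
  exact (memLp_two_iff_integrable_sq h3.1).2 h2

theorem integrable_integral_sq {h : Strip n → ℝ} (hh : MemLp h 2 volume) :
    Integrable (fun z : ℝ => ∫ x, h (x, z) ^ 2) volume :=
  Integrable.integral_prod_right (f := fun p : Strip n => h p ^ 2) hh.integrable_sq

/-- The hypothesis `hb` is Bessel's inequality on slices, supplied by Parseval for sine and cosine
modes. -/
theorem MemLp.torusCoeff_of_le {h : Strip n → ℝ} (hh : MemLp h 2 volume)
    {ψ : (Fin n → UnitAddCircle) → ℝ} (hψ : Continuous ψ)
    (hb : ∀ᵐ z, CahnHilliard.torusCoeff ψ h z ^ 2 ≤ ∫ x, h (x, z) ^ 2) :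
    MemLp (CahnHilliard.torusCoeff ψ h) 2 volume := by
  have hm := (LocallyIntegrable.torusCoeff (MemLp.locallyIntegrable_two hh) hψ).aestronglyMeasurable
  rw [memLp_two_iff_integrable_sq hm]
  refine (integrable_integral_sq hh).mono' (hm.pow 2) ?_
  filter_upwards [hb] with z hz
  rwa [Real.norm_eq_abs, abs_of_nonneg (sq_nonneg _)]

theorem ae_hasSum_sq_torusCoeff {h : Strip n → ℝ} (hh : MemLp h 2 volume) :
    ∀ᵐ z : ℝ, HasSum (fun k : Fin n → ℤ => torusCoeff (cosMode k) h z ^ 2 +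
      torusCoeff (sinMode k) h z ^ 2) (∫ x, h (x, z) ^ 2) := by
  filter_upwards [MemLp.ae_slice hh] with z hz
  exact hasSum_sq_torus hz

theorem MemLp.torusCoeff_cosMode {h : Strip n → ℝ} (hh : MemLp h 2 volume) (k : Fin n → ℤ) :
    MemLp (CahnHilliard.torusCoeff (cosMode k) h) 2 volume := by
  refine MemLp.torusCoeff_of_le hh (continuous_cosMode k) ?_
  filter_upwards [ae_hasSum_sq_torusCoeff hh] with z hz
  have := le_hasSum hz k fun _ _ => by positivity
  nlinarith [sq_nonneg (CahnHilliard.torusCoeff (sinMode k) h z)]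

theorem MemLp.torusCoeff_sinMode {h : Strip n → ℝ} (hh : MemLp h 2 volume) (k : Fin n → ℤ) :
    MemLp (CahnHilliard.torusCoeff (sinMode k) h) 2 volume := by
  refine MemLp.torusCoeff_of_le hh (continuous_sinMode k) ?_
  filter_upwards [ae_hasSum_sq_torusCoeff hh] with z hz
  have := le_hasSum hz k fun _ _ => by positivity
  nlinarith [sq_nonneg (CahnHilliard.torusCoeff (cosMode k) h z)]

/-- **Parseval's identity** on the strip, with Fourier series in the torus variable. -/
theorem hasSum_sq_strip {h : Strip n → ℝ} (hh : MemLp h 2 volume) :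
    HasSum (fun k : Fin n → ℤ => (∫ z, torusCoeff (cosMode k) h z ^ 2) +
      ∫ z, torusCoeff (sinMode k) h z ^ 2) (∫ p, h p ^ 2) := by
  let F : (Fin n → ℤ) → ℝ → ℝ := fun k z =>
    torusCoeff (cosMode k) h z ^ 2 + torusCoeff (sinMode k) h z ^ 2
  have iF : ∀ k, Integrable (F k) volume := fun k =>
    (MemLp.torusCoeff_cosMode hh k).integrable_sq.add (MemLp.torusCoeff_sinMode hh k).integrable_sq
  have hF0 : ∀ k z, 0 ≤ F k z := fun k z => by positivity
  have hsum := ae_hasSum_sq_torusCoeff hh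
  have iH := integrable_integral_sq hh
  have hs : Summable fun k => ∫ z, ‖F k z‖ := by
    -- Bessel's inequality on slices bounds all partial sums, which permits exchanging the sum over
    -- k with the integral over z.
    refine summable_of_sum_le (c := ∫ z : ℝ, ∫ x, h (x, z) ^ 2)
      (fun k => integral_nonneg fun z => norm_nonneg _) fun s => ?_
    rw [← integral_finsetSum _ fun k _ => (iF k).norm]
    refine integral_mono_ae (integrable_finsetSum _ fun k _ => (iF k).norm) iH ?_
    filter_upwards [hsum] with z hz
    simp only [Real.norm_of_nonneg (hF0 _ z)]
    exact sum_le_hasSum s (fun k _ => hF0 k z) hz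
  have key := hasSum_integral_of_summable_integral_norm iF hs
  have e1 : ∫ z, ∑' k, F k z = ∫ p, h p ^ 2 := by
    have : ∫ p, h p ^ 2 = ∫ z : ℝ, ∫ x, h (x, z) ^ 2 :=
      integral_prod_symm (fun p : Strip n => h p ^ 2) hh.integrable_sq
    rw [this]
    refine integral_congr_ae ?_
    filter_upwards [hsum] with z hz
    exact hz.tsum_eq
  rw [e1] at key
  convert! key using 1
  funext k
  exact (integral_add (MemLp.torusCoeff_cosMode hh k).integrable_sq
    (MemLp.torusCoeff_sinMode hh k).integrable_sq).symm

/-- A locally integrable function on the strip is determined by its Fourier coefficients in the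
torus variable. -/
theorem ae_eq_zero_of_torusCoeff_ae_eq_zero {d : Strip n → ℝ} (hd : LocallyIntegrable d volume)
    (hc : ∀ k, torusCoeff (cosMode k) d =ᵐ[volume] 0)
    (hs : ∀ k, torusCoeff (sinMode k) d =ᵐ[volume] 0) : d =ᵐ[volume] 0 := by
  have hz : ∀ᵐ z : ℝ, ∫⁻ x, ‖d (x, z)‖ₑ = 0 := by
    filter_upwards [ae_all_iff.2 hc, ae_all_iff.2 hs, LocallyIntegrable.ae_integrable_slice hd]
      with z h1 h2 h3
    have h4 := ae_eq_zero_of_torus_coeff_eq_zero h3 h1 h2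
    rw [lintegral_congr_ae (g := fun _ => 0) (by filter_upwards [h4] with x hx; simp [hx])]
    simp
  have hm : AEMeasurable (fun p => ‖d p‖ₑ) (volume : Measure (Strip n)) :=
    hd.aestronglyMeasurable.enorm
  have h0 : ∫⁻ p, ‖d p‖ₑ = 0 := by
    rw [Measure.volume_eq_prod] at hm ⊢
    rw [lintegral_prod_symm _ hm, lintegral_congr_ae hz]
    simp
  rw [lintegral_eq_zero_iff' hm] at h0
  filter_upwards [h0] with p hp
  simpa using hp

/-! ### Test functions and calculus of weak derivatives on the strip. -/

/-- The displacement on the covering space. -/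
def coverStep : Dir n → (Fin n → ℝ) × ℝ
  | Sum.inl i => (Pi.single i 1, 0)
  | Sum.inr _ => (0, 1)

theorem proj_add_step (j : Dir n) (y : (Fin n → ℝ) × ℝ) (t : ℝ) :
    proj y + step j t = proj (y + t • coverStep j) := by
  cases j with
  | inl i =>
    refine Prod.ext ?_ (by simp [proj, step, coverStep])
    funext l
    by_cases hl : l = i
    · subst hl; simp [proj, step, coverStep]
    · simp [proj, step, coverStep, hl]
  | inr i =>
    refine Prod.ext ?_ (by simp [proj, step, coverStep])
    funext l
    simp [proj, step, coverStep]

theorem proj_surjective : Function.Surjective (proj (n := n)) := fun p => by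
  choose y hy using fun i => QuotientAddGroup.mk_surjective (p.1 i)
  exact ⟨(y, p.2), Prod.ext (funext hy) rfl⟩

/-- Lets continuity descend from the covering space, where smoothness of test functions is tested.
-/
theorem isOpenQuotientMap_proj : IsOpenQuotientMap (proj (n := n)) := by
  have h1 : IsOpenQuotientMap (fun (y : Fin n → ℝ) (i : Fin n) => (y i : UnitAddCircle)) :=
    IsOpenQuotientMap.piMap fun _ => QuotientAddGroup.isOpenQuotientMap_mk
  exact h1.prodMap IsOpenQuotientMap.id

theorem IsTestFunction.continuous {φ : Strip n → ℝ} (h : IsTestFunction φ) : Continuous φ :=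
  isOpenQuotientMap_proj.isQuotientMap.continuous_iff.2 h.smooth.continuous

theorem hasDerivAt_step_of_contDiff {φ : Strip n → ℝ}
    (h : ContDiff ℝ ∞ (fun y : (Fin n → ℝ) × ℝ => φ (proj y))) (j : Dir n) (p : Strip n) :
    HasDerivAt (fun t : ℝ => φ (p + step j t)) (partialDeriv j φ p) 0 := by
  obtain ⟨y, rfl⟩ := proj_surjective p
  have e : (fun t : ℝ => φ (proj y + step j t)) = fun t : ℝ => φ (proj (y + t • coverStep j)) :=
    funext fun t => by rw [proj_add_step]
  refine DifferentiableAt.hasDerivAt ?_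
  rw [e]
  have hd : Differentiable ℝ fun t : ℝ => y + t • coverStep j := by fun_prop
  exact ((h.differentiable (by simp)).comp hd) 0

theorem contDiff_partialDeriv {φ : Strip n → ℝ}
    (h : ContDiff ℝ ∞ (fun y : (Fin n → ℝ) × ℝ => φ (proj y))) (j : Dir n) :
    ContDiff ℝ ∞ (fun y : (Fin n → ℝ) × ℝ => partialDeriv j φ (proj y)) := by
  have e : (fun y : (Fin n → ℝ) × ℝ => partialDeriv j φ (proj y)) =
      fun y => fderiv ℝ (fun y : (Fin n → ℝ) × ℝ => φ (proj y)) y (coverStep j) := by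
    funext y
    have hd : HasDerivAt (fun t : ℝ => y + t • coverStep j) (coverStep j) 0 := by
      simpa using ((hasDerivAt_id (0 : ℝ)).smul_const (coverStep j)).const_add y
    have hf : HasFDerivAt (fun y : (Fin n → ℝ) × ℝ => φ (proj y))
        (fderiv ℝ (fun y : (Fin n → ℝ) × ℝ => φ (proj y)) y) (y + (0 : ℝ) • coverStep j) := by
      rw [zero_smul, add_zero]
      exact (h.differentiable (by simp) y).hasFDerivAt
    have hc := hf.comp_hasDerivAt (0 : ℝ) hd
    rw [partialDeriv, ← hc.deriv]
    congr 1
    funext t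
    rw [proj_add_step]; rfl
  rw [e]
  exact (h.fderiv_right (m := ∞) (by simp)).clm_apply contDiff_const

theorem IsTestFunction.partialDeriv {φ : Strip n → ℝ} (h : IsTestFunction φ) (j : Dir n) :
    IsTestFunction (CahnHilliard.partialDeriv j φ) := by
  refine ⟨contDiff_partialDeriv h.smooth j, h.compact.mono' fun p hp => ?_⟩
  by_contra hne
  apply hp
  have hev : φ =ᶠ[𝓝 p] 0 := notMem_tsupport_iff_eventuallyEq.1 hne
  have hcont : ContinuousAt (fun t : ℝ => p + step j t) 0 := by
    have : Continuous fun t : ℝ => step j t := by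
      cases j with
      | inl i =>
        refine Continuous.prodMk ?_ continuous_const
        exact (continuous_single (A := fun _ : Fin n => UnitAddCircle) i).comp
          (AddCircle.continuous_mk' 1)
      | inr i => exact continuous_const.prodMk continuous_id
    exact (continuous_const.add this).continuousAt
  have h0 : step j 0 = (0 : Strip n) := by cases j <;> simp [step]
  have hev' : ∀ᶠ t in 𝓝 (0 : ℝ), φ (p + step j t) = 0 := by
    have ht : Tendsto (fun t : ℝ => p + step j t) (𝓝 0) (𝓝 p) := by
      simpa [ContinuousAt, h0] using hcont
    exact ht.eventually hev
  rw [CahnHilliard.partialDeriv, Filter.EventuallyEq.deriv_eq (f := fun _ => (0 : ℝ)) hev']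
  simp

theorem LocallyIntegrable.integrable_mul_test {f φ : Strip n → ℝ} (hf : LocallyIntegrable f volume)
    (hφ : IsTestFunction φ) : Integrable (fun p => f p * φ p) volume := by
  simpa [mul_comm] using hf.integrable_smul_left_of_hasCompactSupport hφ.continuous hφ.compact

theorem contDiff_comp_proj_snd {b : ℝ → ℝ} (hb : ContDiff ℝ ∞ b) :
    ContDiff ℝ ∞ (fun y : (Fin n → ℝ) × ℝ => (fun p : Strip n => b p.2) (proj y)) :=
  hb.comp contDiff_snd

/-- The derivative of a function of `z` in direction `j`. -/
noncomputable def dirDeriv (j : Dir n) (b : ℝ → ℝ) : ℝ → ℝ :=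
  match j with
  | Sum.inl _ => 0
  | Sum.inr _ => deriv b

theorem hasDerivAt_step_snd {b : ℝ → ℝ} (hb : Differentiable ℝ b) (j : Dir n) (p : Strip n) :
    HasDerivAt (fun t : ℝ => b (p + step j t).2) (dirDeriv j b p.2) 0 := by
  cases j with
  | inl i => simpa [step, dirDeriv] using hasDerivAt_const (0 : ℝ) (b p.2)
  | inr i =>
    have h := HasDerivAt.comp_const_add p.2 (0 : ℝ) (by rw [add_zero]; exact (hb p.2).hasDerivAt)
    simpa [step, dirDeriv] using h

/-- The weak product rule comes from the classical one for the test function bφ. -/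
theorem HasWeakDeriv.mul_snd {j : Dir n} {f g : Strip n → ℝ} (h : HasWeakDeriv j f g) {b : ℝ → ℝ}
    (hb : ContDiff ℝ ∞ b) :
    HasWeakDeriv j (fun p => b p.2 * f p) (fun p => b p.2 * g p + dirDeriv j b p.2 * f p) := by
  have cb : Continuous fun p : Strip n => b p.2 := hb.continuous.comp continuous_snd
  have cd : Continuous fun p : Strip n => dirDeriv j b p.2 := by
    cases j with
    | inl i => exact continuous_const
    | inr i => exact (hb.continuous_deriv (by simp)).comp continuous_snd
  have lf : LocallyIntegrable (fun p : Strip n => b p.2 * f p) volume := by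
    simpa using h.1.continuous_smul cb
  have lg : LocallyIntegrable (fun p : Strip n => b p.2 * g p) volume := by
    simpa using h.2.1.continuous_smul cb
  have ld : LocallyIntegrable (fun p : Strip n => dirDeriv j b p.2 * f p) volume := by
    simpa using h.1.continuous_smul cd
  refine ⟨lf, lg.add ld, fun φ hφ => ?_⟩
  have hφb : IsTestFunction (fun p : Strip n => b p.2 * φ p) :=
    ⟨(contDiff_comp_proj_snd hb).mul hφ.smooth, hφ.compact.mul_left⟩
  have e := h.2.2 _ hφb
  have hp : ∀ p, partialDeriv j (fun p : Strip n => b p.2 * φ p) p =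
      dirDeriv j b p.2 * φ p + b p.2 * partialDeriv j φ p := fun p => by
    have h1 := (hasDerivAt_step_snd (hb.differentiable (by simp)) j p).mul
      (hasDerivAt_step_of_contDiff hφ.smooth j p)
    have h0 : step j 0 = (0 : Strip n) := by cases j <;> simp [step]
    rw [h0, add_zero] at h1
    exact h1.deriv
  simp only [hp] at e
  have i1 := LocallyIntegrable.integrable_mul_test ld hφ
  have i2 := LocallyIntegrable.integrable_mul_test lf (hφ.partialDeriv j)
  have i3 := LocallyIntegrable.integrable_mul_test lg hφ
  have e1 : ∀ p : Strip n, f p * (dirDeriv j b p.2 * φ p + b p.2 * partialDeriv j φ p) =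
      dirDeriv j b p.2 * f p * φ p + b p.2 * f p * partialDeriv j φ p := fun p => by ring
  have e2 : ∀ p : Strip n, g p * (b p.2 * φ p) = b p.2 * g p * φ p := fun p => by ring
  have e3 : ∀ p : Strip n, (b p.2 * g p + dirDeriv j b p.2 * f p) * φ p =
      b p.2 * g p * φ p + dirDeriv j b p.2 * f p * φ p := fun p => by ring
  simp only [e1, e2] at e
  simp only [e3]
  rw [integral_add i1 i2] at e
  rw [integral_add i3 i1]
  linarith

theorem HasWeakDeriv.add {j : Dir n} {f g f' g' : Strip n → ℝ} (h : HasWeakDeriv j f g)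
    (h' : HasWeakDeriv j f' g') :
    HasWeakDeriv j (fun p => f p + f' p) (fun p => g p + g' p) := by
  refine ⟨h.1.add h'.1, h.2.1.add h'.2.1, fun φ hφ => ?_⟩
  simp only [add_mul]
  rw [integral_add (LocallyIntegrable.integrable_mul_test h.1 (hφ.partialDeriv j))
      (LocallyIntegrable.integrable_mul_test h'.1 (hφ.partialDeriv j)),
    integral_add (LocallyIntegrable.integrable_mul_test h.2.1 hφ)
      (LocallyIntegrable.integrable_mul_test h'.2.1 hφ), h.2.2 φ hφ, h'.2.2 φ hφ]
  ring

theorem HasWeakDeriv.neg {j : Dir n} {f g : Strip n → ℝ} (h : HasWeakDeriv j f g) :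
    HasWeakDeriv j (fun p => - f p) (fun p => - g p) := by
  refine ⟨h.1.neg, h.2.1.neg, fun φ hφ => ?_⟩
  simp only [neg_mul]
  rw [integral_neg, integral_neg, h.2.2 φ hφ]

theorem HasWeakDeriv.sum {ι : Type*} {j : Dir n} {f g : ι → Strip n → ℝ} (s : Finset ι)
    (h : ∀ i ∈ s, HasWeakDeriv j (f i) (g i)) :
    HasWeakDeriv j (fun p => ∑ i ∈ s, f i p) (fun p => ∑ i ∈ s, g i p) := by
  classical
  induction s using Finset.induction_on with
  | empty =>
    refine ⟨?_, ?_, fun φ hφ => ?_⟩ <;> simp [locallyIntegrable_zero]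
  | insert a s ha ih =>
    simp only [Finset.sum_insert ha]
    exact (h a (Finset.mem_insert_self a s)).add
      (ih fun i hi => h i (Finset.mem_insert_of_mem hi))

theorem HasWeakDeriv.congr {j : Dir n} {f g f' g' : Strip n → ℝ} (h : HasWeakDeriv j f g)
    (e : f =ᵐ[volume] f') (e' : g =ᵐ[volume] g') : HasWeakDeriv j f' g' := by
  refine ⟨h.1.congr e, h.2.1.congr e', fun φ hφ => ?_⟩
  have h1 : ∫ p, f' p * CahnHilliard.partialDeriv j φ p = ∫ p, f p * CahnHilliard.partialDeriv j φ p :=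
    integral_congr_ae (by filter_upwards [e] with z hz; rw [hz])
  have h2 : ∫ p, g' p * φ p = ∫ p, g p * φ p :=
    integral_congr_ae (by filter_upwards [e'] with z hz; rw [hz])
  rw [h1, h2, h.2.2 φ hφ]

/-! ### Fourier modes as test functions; uniqueness of weak derivatives. -/

/-- A smooth function on the torus together with its partial derivatives. -/
structure IsSmoothMode (ψ : (Fin n → UnitAddCircle) → ℝ)
    (ψ' : Fin n → (Fin n → UnitAddCircle) → ℝ) : Prop where
  smooth : ContDiff ℝ ∞ fun y : Fin n → ℝ => ψ fun i => (y i : UnitAddCircle)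
  continuous : Continuous ψ
  continuous' : ∀ i, Continuous (ψ' i)
  hasDerivAt : ∀ i x,
    HasDerivAt (fun t : ℝ => ψ (x + Pi.single i (t : UnitAddCircle))) (ψ' i x) 0

theorem contDiff_phase (k : Fin n → ℤ) :
    ContDiff ℝ ∞ fun y : Fin n → ℝ => 2 * Real.pi * ∑ i, (k i : ℝ) * y i := by fun_prop

theorem hasDerivAt_phase (k : Fin n → ℤ) (i : Fin n) (y : Fin n → ℝ) :
    HasDerivAt (fun t : ℝ => 2 * Real.pi * ∑ l, (k l : ℝ) * (y l + (Pi.single i t : Fin n → ℝ) l))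
      (2 * Real.pi * k i) 0 := by
  have e : (fun t : ℝ => 2 * Real.pi * ∑ l, (k l : ℝ) * (y l + (Pi.single i t : Fin n → ℝ) l)) =
      fun t => 2 * Real.pi * ((∑ l, (k l : ℝ) * y l) + k i * t) := by
    funext t
    simp [mul_add, Finset.sum_add_distrib, Pi.single_apply]
  rw [e]
  have := (((hasDerivAt_id (0 : ℝ)).const_mul (k i : ℝ)).const_add
    (∑ l, (k l : ℝ) * y l)).const_mul (2 * Real.pi)
  simpa using this

theorem coe_add_single (y : Fin n → ℝ) (i : Fin n) (t : ℝ) :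
    (fun l => (y l : UnitAddCircle)) + Pi.single i (t : UnitAddCircle) =
      fun l => (((y l + (Pi.single i t : Fin n → ℝ) l) : ℝ) : UnitAddCircle) := by
  funext l
  by_cases hl : l = i
  · subst hl; simp
  · simp [hl]

theorem isSmoothMode_cosMode (k : Fin n → ℤ) :
    IsSmoothMode (cosMode k) (fun i x => -(2 * Real.pi * k i) * sinMode k x) where
  smooth := by
    simp only [cosMode_coe]
    exact Real.contDiff_cos.comp (contDiff_phase k)
  continuous := continuous_cosMode k
  continuous' i := (continuous_sinMode k).const_mul _
  hasDerivAt i x := by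
    choose y hy using fun l => QuotientAddGroup.mk_surjective (x l)
    obtain rfl : (fun l => (y l : UnitAddCircle)) = x := funext hy
    simp only [coe_add_single, cosMode_coe, sinMode_coe]
    refine (hasDerivAt_phase k i y).cos.congr_deriv ?_
    simp; ring

theorem isSmoothMode_sinMode (k : Fin n → ℤ) :
    IsSmoothMode (sinMode k) (fun i x => (2 * Real.pi * k i) * cosMode k x) where
  smooth := by
    simp only [sinMode_coe]
    exact Real.contDiff_sin.comp (contDiff_phase k)
  continuous := continuous_sinMode k
  continuous' i := (continuous_cosMode k).const_mul _
  hasDerivAt i x := by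
    choose y hy using fun l => QuotientAddGroup.mk_surjective (x l)
    obtain rfl : (fun l => (y l : UnitAddCircle)) = x := funext hy
    simp only [coe_add_single, cosMode_coe, sinMode_coe]
    refine (hasDerivAt_phase k i y).sin.congr_deriv ?_
    simp; ring

namespace IsSmoothMode

variable {ψ : (Fin n → UnitAddCircle) → ℝ} {ψ' : Fin n → (Fin n → UnitAddCircle) → ℝ}

theorem isTestFunction (hψ : IsSmoothMode ψ ψ') {η : ℝ → ℝ} (hη : ContDiff ℝ ∞ η)
    (hc : HasCompactSupport η) : IsTestFunction (fun p : Strip n => ψ p.1 * η p.2) :=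
  ⟨(hψ.smooth.comp contDiff_fst).mul (hη.comp contDiff_snd), hasCompactSupport_torus_mul hc ψ⟩

theorem partialDeriv_inl (hψ : IsSmoothMode ψ ψ') (η : ℝ → ℝ) (i : Fin n) (p : Strip n) :
    partialDeriv (Sum.inl i) (fun p : Strip n => ψ p.1 * η p.2) p = ψ' i p.1 * η p.2 := by
  have h := (hψ.hasDerivAt i p.1).mul_const (η p.2)
  rw [partialDeriv, ← h.deriv]
  simp [step]

theorem partialDeriv_inr {η : ℝ → ℝ} (hη : Differentiable ℝ η) (u : Unit) (p : Strip n) :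
    partialDeriv (Sum.inr u) (fun p : Strip n => ψ p.1 * η p.2) p = ψ p.1 * deriv η p.2 := by
  have h := (hasDerivAt_step_snd hη (Sum.inr u : Dir n) p).const_mul (ψ p.1)
  rw [partialDeriv]
  simpa [step, dirDeriv] using h.deriv

theorem hasWeakDerivReal_torusCoeff (hψ : IsSmoothMode ψ ψ') {f g : Strip n → ℝ} {u : Unit}
    (h : HasWeakDeriv (Sum.inr u) f g) :
    HasWeakDerivReal (torusCoeff ψ f) (torusCoeff ψ g) := fun η hη hc => by
  have e := h.2.2 _ (hψ.isTestFunction hη hc)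
  simp only [partialDeriv_inr (hη.differentiable (by simp))] at e
  rw [LocallyIntegrable.integral_mul_torus_mul h.1 hψ.continuous
      (hη.continuous_deriv (by simp)) hc.deriv,
    LocallyIntegrable.integral_mul_torus_mul h.2.1 hψ.continuous hη.continuous hc] at e
  exact e

/-- Testing with ψ(x')η(z) moves the torus derivative onto ψ; as η is arbitrary, the identity holds
for almost every z. -/
theorem torusCoeff_ae_eq (hψ : IsSmoothMode ψ ψ') {f g : Strip n → ℝ} {i : Fin n}
    (h : HasWeakDeriv (Sum.inl i) f g) :
    torusCoeff ψ g =ᵐ[volume] fun z => - torusCoeff (ψ' i) f z := by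
  refine ae_eq_of_integral_contDiff_smul_eq (LocallyIntegrable.torusCoeff h.2.1 hψ.continuous)
    (LocallyIntegrable.torusCoeff h.1 (hψ.continuous' i)).neg fun η hη hc => ?_
  have e := h.2.2 _ (hψ.isTestFunction hη hc)
  simp only [hψ.partialDeriv_inl] at e
  rw [LocallyIntegrable.integral_mul_torus_mul h.1 (hψ.continuous' i) hη.continuous hc,
    LocallyIntegrable.integral_mul_torus_mul h.2.1 hψ.continuous hη.continuous hc] at e
  simp only [smul_eq_mul, mul_comm (η _), neg_mul, integral_neg]
  linarith

theorem torusCoeff_ae_eq_zero (hψ : IsSmoothMode ψ ψ') {d : Strip n → ℝ}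
    (hd : LocallyIntegrable d volume) (h : ∀ φ, IsTestFunction φ → ∫ p, d p * φ p = 0) :
    torusCoeff ψ d =ᵐ[volume] 0 := by
  refine ae_eq_zero_of_integral_contDiff_smul_eq_zero
    (LocallyIntegrable.torusCoeff hd hψ.continuous) fun η hη hc => ?_
  have e := h _ (hψ.isTestFunction hη hc)
  rw [LocallyIntegrable.integral_mul_torus_mul hd hψ.continuous hη.continuous hc] at e
  simpa [mul_comm] using e

end IsSmoothMode

/-- The difference annihilates all products of a Fourier mode with a test function of z, so its
torus coefficients vanish. This makes the choice of representative in `weakDeriv` harmless. -/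
theorem HasWeakDeriv.ae_unique {j : Dir n} {f g g' : Strip n → ℝ} (h : HasWeakDeriv j f g)
    (h' : HasWeakDeriv j f g') : g =ᵐ[volume] g' := by
  have hd := h.2.1.sub h'.2.1
  have h0 : ∀ φ, IsTestFunction φ → ∫ p, (g - g') p * φ p = 0 := fun φ hφ => by
    simp only [Pi.sub_apply, sub_mul]
    rw [integral_sub (LocallyIntegrable.integrable_mul_test h.2.1 hφ)
      (LocallyIntegrable.integrable_mul_test h'.2.1 hφ)]
    linarith [h.2.2 φ hφ, h'.2.2 φ hφ]
  have := ae_eq_zero_of_torusCoeff_ae_eq_zero hd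
    (fun k => (isSmoothMode_cosMode k).torusCoeff_ae_eq_zero hd h0)
    (fun k => (isSmoothMode_sinMode k).torusCoeff_ae_eq_zero hd h0)
  filter_upwards [this] with p hp
  simpa [sub_eq_zero] using hp

theorem HasWeakDeriv.hasWeakDeriv_weakDeriv {j : Dir n} {f g : Strip n → ℝ}
    (h : HasWeakDeriv j f g) : HasWeakDeriv j f (weakDeriv j f) := by
  have hex : ∃ g, HasWeakDeriv j f g := ⟨g, h⟩
  rw [weakDeriv, dif_pos hex]
  exact hex.choose_spec

theorem HasWeakDeriv.weakDeriv_ae_eq {j : Dir n} {f g : Strip n → ℝ}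
    (h : HasWeakDeriv j f g) : weakDeriv j f =ᵐ[volume] g :=
  h.hasWeakDeriv_weakDeriv.ae_unique h

/-! ### Sobolev functions and the linearized operator. -/

theorem MemSobolev.memLp {k : ℕ} {f : Strip n → ℝ} (h : MemSobolev k f) : MemLp f 2 volume := by
  cases k with
  | zero => exact h
  | succ k => exact h.1

theorem MemSobolev.congr {k : ℕ} {f f' : Strip n → ℝ} (h : MemSobolev k f)
    (e : f =ᵐ[volume] f') : MemSobolev k f' := by
  cases k with
  | zero => exact MemLp.ae_eq e h
  | succ k =>
    refine ⟨h.1.ae_eq e, fun j => ?_⟩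
    obtain ⟨g, hg, hk⟩ := h.2 j
    exact ⟨g, hg.congr e (ae_eq_refl g), hk⟩

theorem MemSobolev.hasWeakDeriv {k : ℕ} {f : Strip n → ℝ} (h : MemSobolev (k + 1) f) (j : Dir n) :
    HasWeakDeriv j f (weakDeriv j f) := by
  obtain ⟨g, hg, -⟩ := h.2 j
  exact hg.hasWeakDeriv_weakDeriv

theorem MemSobolev.weakDeriv {k : ℕ} {f : Strip n → ℝ} (h : MemSobolev (k + 1) f) (j : Dir n) :
    MemSobolev k (weakDeriv j f) := by
  obtain ⟨g, hg, hk⟩ := h.2 j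
  exact hk.congr hg.weakDeriv_ae_eq.symm

theorem MemLp.snd_mul {b : ℝ → ℝ} (hb : Continuous b) (B : ℝ) (hB : ∀ z, |b z| ≤ B)
    {f : Strip n → ℝ} (hf : MemLp f 2 volume) : MemLp (fun p => b p.2 * f p) 2 volume := by
  refine (hf.const_mul B).of_le ((hb.comp continuous_snd).aestronglyMeasurable.mul hf.1)
    (Eventually.of_forall fun p => ?_)
  rw [norm_mul, norm_mul]
  exact mul_le_mul_of_nonneg_right ((hB p.2).trans (le_abs_self B)) (norm_nonneg _)

theorem deriv_deriv_doubleWell (u : ℝ) : deriv (deriv doubleWell) u = 3 * u ^ 2 - 1 := by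
  have h1 : deriv doubleWell = fun u => u ^ 3 - u := by
    funext u
    have h := ((((hasDerivAt_id u).pow 2).const_sub 1).pow 2).div_const 4
    refine HasDerivAt.deriv (h.congr_deriv ?_)
    simp; ring
  rw [h1]
  refine HasDerivAt.deriv ((((hasDerivAt_id u).pow 3).sub (hasDerivAt_id u)).congr_deriv ?_)
  simp

theorem linOp_eq (c : ℝ) (f : Strip n → ℝ) :
    linOp c f = fun p => - ∑ j : Dir n, weakDeriv j (weakDeriv j f) p +
      kinkPotential c p.2 * f p := by
  funext p
  rw [linOp, weakLaplacian, deriv_deriv_doubleWell, kinkPotential]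

theorem contDiff_kinkPotential (c : ℝ) : ContDiff ℝ ∞ (kinkPotential c) :=
  (contDiff_const.mul ((contDiff_kink c).pow 2)).sub contDiff_const

theorem abs_dirDeriv_kinkPotential_le (c : ℝ) (j : Dir n) (z : ℝ) :
    |dirDeriv j (kinkPotential c) z| ≤ 6 := by
  cases j with
  | inl i => simp [dirDeriv]
  | inr i =>
    simp only [dirDeriv]
    rw [(hasDerivAt_kinkPotential c z).deriv, abs_mul, abs_mul, abs_of_pos (by norm_num : (0:ℝ) < 6)]
    have h1 := abs_kink_le_one c z
    have h2 := abs_kinkSlope_le_one c z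
    nlinarith [mul_le_one₀ h1 (abs_nonneg _) h2]

theorem continuous_dirDeriv_kinkPotential (c : ℝ) (j : Dir n) :
    Continuous (dirDeriv j (kinkPotential c)) := by
  cases j with
  | inl i => exact continuous_const
  | inr i => exact (contDiff_kinkPotential c).continuous_deriv (by simp)

theorem memLp_linOp {c : ℝ} {f : Strip n → ℝ} (hf : MemSobolev 3 f) :
    MemLp (linOp c f) 2 volume := by
  rw [linOp_eq]
  exact (memLp_finsetSum _ fun j _ => ((hf.weakDeriv j).weakDeriv j).memLp).neg.add
    (MemLp.snd_mul (continuous_kinkPotential c) 2 (abs_kinkPotential_le c) hf.memLp)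

/-- The place where third derivatives of f are needed; the potential contributes only bounded smooth
factors. -/
theorem exists_hasWeakDeriv_linOp {c : ℝ} {f : Strip n → ℝ} (hf : MemSobolev 3 f) (j : Dir n) :
    ∃ g, HasWeakDeriv j (linOp c f) g ∧ MemLp g 2 volume := by
  rw [linOp_eq]
  refine ⟨_, (HasWeakDeriv.sum Finset.univ fun i _ =>
    ((hf.weakDeriv i).weakDeriv i).hasWeakDeriv j).neg.add
    ((hf.hasWeakDeriv j).mul_snd (contDiff_kinkPotential c)), ?_⟩
  refine (memLp_finsetSum _ fun i _ =>
    (((hf.weakDeriv i).weakDeriv i).weakDeriv j).memLp).neg.add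
    ((MemLp.snd_mul (continuous_kinkPotential c) 2 (abs_kinkPotential_le c)
      (hf.weakDeriv j).memLp).add ?_)
  exact MemLp.snd_mul (continuous_dirDeriv_kinkPotential c j) 6
    (abs_dirDeriv_kinkPotential_le c j) hf.memLp

theorem hasWeakDeriv_linOp {c : ℝ} {f : Strip n → ℝ} (hf : MemSobolev 3 f) (j : Dir n) :
    HasWeakDeriv j (linOp c f) (weakDeriv j (linOp c f)) := by
  obtain ⟨g, hg, -⟩ := exists_hasWeakDeriv_linOp (c := c) hf j
  exact hg.hasWeakDeriv_weakDeriv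

theorem memLp_weakDeriv_linOp {c : ℝ} {f : Strip n → ℝ} (hf : MemSobolev 3 f) (j : Dir n) :
    MemLp (weakDeriv j (linOp c f)) 2 volume := by
  obtain ⟨g, hg, hL⟩ := exists_hasWeakDeriv_linOp (c := c) hf j
  exact hL.ae_eq hg.weakDeriv_ae_eq.symm

/-! ### The estimate mode by mode, and summation. -/

theorem torusCoeff_const_mul (a : ℝ) (ψ : (Fin n → UnitAddCircle) → ℝ) (h : Strip n → ℝ) (z : ℝ) :
    torusCoeff (fun x => a * ψ x) h z = a * torusCoeff ψ h z := by
  simp only [torusCoeff, mul_assoc]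
  rw [integral_const_mul]

theorem torusCoeff_cosMode_ae_eq {f g : Strip n → ℝ} {i : Fin n}
    (h : HasWeakDeriv (Sum.inl i) f g) (k : Fin n → ℤ) :
    torusCoeff (cosMode k) g =ᵐ[volume] fun z => 2 * Real.pi * k i * torusCoeff (sinMode k) f z := by
  filter_upwards [(isSmoothMode_cosMode k).torusCoeff_ae_eq h] with z hz
  rw [hz, torusCoeff_const_mul]; ring

theorem torusCoeff_sinMode_ae_eq {f g : Strip n → ℝ} {i : Fin n}
    (h : HasWeakDeriv (Sum.inl i) f g) (k : Fin n → ℤ) :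
    torusCoeff (sinMode k) g =ᵐ[volume]
      fun z => -(2 * Real.pi * k i) * torusCoeff (cosMode k) f z := by
  filter_upwards [(isSmoothMode_sinMode k).torusCoeff_ae_eq h] with z hz
  rw [hz, torusCoeff_const_mul]; ring

/-- The eigenvalue of `-Δ'` on the `k`-th Fourier mode. -/
noncomputable def modeEigenvalue (k : Fin n → ℤ) : ℝ := ∑ i, (2 * Real.pi * k i) ^ 2

theorem modeEigenvalue_zero : modeEigenvalue (0 : Fin n → ℤ) = 0 := by
  simp [modeEigenvalue]

/-- The spectral gap of the unit torus is 4π², whatever the dimension; 4 is all that the resolvent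
estimate requires. -/
theorem four_le_modeEigenvalue {k : Fin n → ℤ} (hk : k ≠ 0) : 4 ≤ modeEigenvalue k := by
  obtain ⟨i, hi⟩ := Function.ne_iff.1 hk
  have h1 : (2 * Real.pi * k i) ^ 2 ≤ modeEigenvalue k :=
    Finset.single_le_sum (f := fun i => (2 * Real.pi * (k i : ℝ)) ^ 2)
      (fun _ _ => sq_nonneg _) (Finset.mem_univ i)
  have h2 : (1 : ℝ) ≤ (k i : ℝ) ^ 2 := by
    have : (1 : ℤ) ≤ k i ^ 2 := Int.add_one_le_of_lt (by
      have hne : k i ≠ 0 := hi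
      exact lt_of_le_of_ne (sq_nonneg _) (pow_ne_zero 2 hne).symm)
    exact_mod_cast this
  have h3 := Real.pi_gt_three
  have h4 : (9 : ℝ) ≤ Real.pi ^ 2 := by nlinarith
  have h5 : (2 * Real.pi * k i) ^ 2 = 4 * Real.pi ^ 2 * (k i : ℝ) ^ 2 := by ring
  nlinarith

/-- The dissipation estimate for the pairing with a real Fourier mode. -/
theorem torusCoeff_estimate {c : ℝ} {f : Strip n → ℝ} (hf : MemSobolev 3 f) {k : Fin n → ℤ}
    {ψ : (Fin n → UnitAddCircle) → ℝ} {ψ' : Fin n → (Fin n → UnitAddCircle) → ℝ}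
    (hψ : IsSmoothMode ψ ψ')
    (hL : ∀ h : Strip n → ℝ, MemLp h 2 volume → MemLp (torusCoeff ψ h) 2 volume)
    (hii : ∀ i, torusCoeff ψ (weakDeriv (Sum.inl i) (weakDeriv (Sum.inl i) f)) =ᵐ[volume]
      fun z => -(2 * Real.pi * k i) ^ 2 * torusCoeff ψ f z)
    (h0 : k = 0 → ∫ z, kinkSlope c z * torusCoeff ψ f z = 0) :
    modeEigenvalue k * (∫ z, torusCoeff ψ f z ^ 2) +
        (∫ z, torusCoeff ψ (weakDeriv (Sum.inr ()) f) z ^ 2) ≤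
      dissipationConst * (modeEigenvalue k * (∫ z, torusCoeff ψ (linOp c f) z ^ 2) +
        (∫ z, torusCoeff ψ (weakDeriv (Sum.inr ()) (linOp c f)) z ^ 2)) := by
  -- Projecting the definition of the linearized operator onto the mode: by `hii` the torus part of
  -- the Laplacian becomes multiplication by minus the eigenvalue, leaving the resolvent equation in
  -- z.
  have hw : torusCoeff ψ (weakDeriv (Sum.inr ()) (weakDeriv (Sum.inr ()) f)) =ᵐ[volume]
      fun z => (kinkPotential c z + modeEigenvalue k) * torusCoeff ψ f z -
        torusCoeff ψ (linOp c f) z := by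
    have hs : ∀ j : Dir n, ∀ᵐ z : ℝ,
        Integrable (fun x => weakDeriv j (weakDeriv j f) (x, z)) volume := fun j =>
      LocallyIntegrable.ae_integrable_slice
        (MemLp.locallyIntegrable_two ((hf.weakDeriv j).weakDeriv j).memLp)
    filter_upwards [ae_all_iff.2 hii, ae_all_iff.2 hs, LocallyIntegrable.ae_integrable_slice
      (MemLp.locallyIntegrable_two hf.memLp)] with z h1 h2 h3
    have e : torusCoeff ψ (linOp c f) z =
        - ∑ j : Dir n, torusCoeff ψ (weakDeriv j (weakDeriv j f)) z +
          kinkPotential c z * torusCoeff ψ f z := by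
      have i1 : ∀ j : Dir n, Integrable (fun x => ψ x * weakDeriv j (weakDeriv j f) (x, z)) volume :=
        fun j => integrable_continuous_mul_torus (h2 j) hψ.continuous
      have i2 : Integrable (fun x => ψ x * f (x, z)) volume :=
        integrable_continuous_mul_torus h3 hψ.continuous
      have i3 : Integrable (fun x => -∑ j : Dir n, ψ x * weakDeriv j (weakDeriv j f) (x, z))
          volume := (integrable_finsetSum _ fun j _ => i1 j).neg
      simp only [torusCoeff]
      rw [← integral_const_mul, ← integral_finsetSum _ fun j _ => i1 j, ← integral_neg,
        ← integral_add i3 (i2.const_mul _)]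
      refine integral_congr_ae (Eventually.of_forall fun x => ?_)
      simp only [linOp_eq]
      rw [← Finset.mul_sum]
      ring
    rw [e, Fintype.sum_sum_type]
    simp only [h1, Finset.univ_unique, Finset.sum_singleton, PUnit.default_eq_unit]
    rw [← Finset.sum_mul, Finset.sum_neg_distrib, ← modeEigenvalue]
    ring
  refine mode_estimate (c := c) (hL _ hf.memLp) (hL _ (hf.weakDeriv _).memLp)
    (hL _ (memLp_linOp hf)) (hL _ (memLp_weakDeriv_linOp hf _))
    (hψ.hasWeakDerivReal_torusCoeff (hf.hasWeakDeriv _))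
    ((hψ.hasWeakDerivReal_torusCoeff ((hf.weakDeriv _).hasWeakDeriv _)).congr (ae_eq_refl _) hw)
    (hψ.hasWeakDerivReal_torusCoeff (hasWeakDeriv_linOp hf _)) ?_
  by_cases hk : k = 0
  · left
    exact ⟨by rw [hk, modeEigenvalue_zero], h0 hk⟩
  · right
    exact four_le_modeEigenvalue hk

/-- The squared `L²` norm of the `k`-th Fourier component. -/
noncomputable def modeEnergy (k : Fin n → ℤ) (h : Strip n → ℝ) : ℝ :=
  (∫ z, torusCoeff (cosMode k) h z ^ 2) + ∫ z, torusCoeff (sinMode k) h z ^ 2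

/-- A torus derivative exchanges cosine and sine coefficients, which is why both are collected in
one energy. -/
theorem modeEnergy_inl {f g : Strip n → ℝ} {i : Fin n} (h : HasWeakDeriv (Sum.inl i) f g)
    (k : Fin n → ℤ) : modeEnergy k g = (2 * Real.pi * k i) ^ 2 * modeEnergy k f := by
  have e1 : ∫ z, torusCoeff (cosMode k) g z ^ 2 =
      (2 * Real.pi * k i) ^ 2 * ∫ z, torusCoeff (sinMode k) f z ^ 2 := by
    rw [← integral_const_mul]
    refine integral_congr_ae ?_
    filter_upwards [torusCoeff_cosMode_ae_eq h k] with z hz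
    rw [hz]; ring
  have e2 : ∫ z, torusCoeff (sinMode k) g z ^ 2 =
      (2 * Real.pi * k i) ^ 2 * ∫ z, torusCoeff (cosMode k) f z ^ 2 := by
    rw [← integral_const_mul]
    refine integral_congr_ae ?_
    filter_upwards [torusCoeff_sinMode_ae_eq h k] with z hz
    rw [hz]; ring
  rw [modeEnergy, e1, e2, modeEnergy]; ring

theorem sum_modeEnergy_eq {f : Strip n → ℝ} (h : ∀ j, HasWeakDeriv j f (weakDeriv j f))
    (k : Fin n → ℤ) :
    ∑ j : Dir n, modeEnergy k (weakDeriv j f) =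
      modeEigenvalue k * modeEnergy k f + modeEnergy k (weakDeriv (Sum.inr ()) f) := by
  rw [Fintype.sum_sum_type]
  simp only [modeEnergy_inl (h _), Finset.univ_unique, Finset.sum_singleton, PUnit.default_eq_unit]
  rw [← Finset.sum_mul, ← modeEigenvalue]

/-- By Fubini, the orthogonality condition on f concerns only its mean over the torus. -/
theorem integral_kinkSlope_mul_torusCoeff_zero {c : ℝ} {f : Strip n → ℝ} (hf : MemLp f 2 volume)
    (h : ∫ p, f p * deriv (kink c) p.2 = 0) :
    ∫ z, kinkSlope c z * torusCoeff (cosMode 0) f z = 0 := by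
  rw [deriv_kink] at h
  have hs : MemLp (fun p : Strip n => kinkSlope c p.2) 2 volume :=
    (memLp_kinkSlope c).comp_measurePreserving measurePreserving_snd
  have hi : Integrable (fun p : Strip n => f p * kinkSlope c p.2) volume := hf.integrable_mul hs
  rw [Measure.volume_eq_prod] at hi h
  rw [integral_prod_symm _ hi] at h
  rw [← h]
  refine integral_congr_ae (Eventually.of_forall fun z => ?_)
  simp only [torusCoeff, cosMode_zero, one_mul]
  rw [integral_mul_const, mul_comm]

theorem sum_modeEnergy_le {c : ℝ} {f : Strip n → ℝ} (hf : MemSobolev 3 f)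
    (h : ∫ p, f p * deriv (kink c) p.2 = 0) (k : Fin n → ℤ) :
    ∑ j : Dir n, modeEnergy k (weakDeriv j f) ≤
      dissipationConst * ∑ j : Dir n, modeEnergy k (weakDeriv j (linOp c f)) := by
  rw [sum_modeEnergy_eq hf.hasWeakDeriv, sum_modeEnergy_eq (hasWeakDeriv_linOp hf)]
  have h1 := torusCoeff_estimate (c := c) hf (k := k) (isSmoothMode_cosMode k)
    (fun h hh => MemLp.torusCoeff_cosMode hh k) (fun i => by
      filter_upwards [torusCoeff_cosMode_ae_eq ((hf.weakDeriv (Sum.inl i)).hasWeakDeriv _) k,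
        torusCoeff_sinMode_ae_eq (hf.hasWeakDeriv (Sum.inl i)) k] with z h1 h2
      rw [h1, h2]; ring) (fun hk => by
      subst hk; exact integral_kinkSlope_mul_torusCoeff_zero hf.memLp h)
  have h2 := torusCoeff_estimate (c := c) hf (k := k) (isSmoothMode_sinMode k)
    (fun h hh => MemLp.torusCoeff_sinMode hh k) (fun i => by
      filter_upwards [torusCoeff_sinMode_ae_eq ((hf.weakDeriv (Sum.inl i)).hasWeakDeriv _) k,
        torusCoeff_cosMode_ae_eq (hf.hasWeakDeriv (Sum.inl i)) k] with z h1 h2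
      rw [h1, h2]; ring) (fun hk => by
      -- The sine mode of frequency zero vanishes identically, so no orthogonality is needed.
      subst hk; simp [torusCoeff, sinMode_zero])
  simp only [modeEnergy]
  linarith

theorem hasSum_gradNormSq {f : Strip n → ℝ} (h : ∀ j, MemLp (weakDeriv j f) 2 volume) :
    HasSum (fun k : Fin n → ℤ => ∑ j : Dir n, modeEnergy k (weakDeriv j f)) (gradNormSq f) := by
  rw [gradNormSq, integral_finsetSum _ fun j _ => (h j).integrable_sq]
  exact hasSum_sum fun j _ => hasSum_sq_strip (h j)

end CahnHilliard

theorem lemma3p7 :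
    ∃ C : ℝ, 0 < C ∧ ∀ (n : ℕ) (c : ℝ) (f : CahnHilliard.Strip n → ℝ),
      CahnHilliard.MemSobolev 3 f →
      ∫ p, f p * deriv (CahnHilliard.kink c) p.2 = 0 →
      CahnHilliard.gradNormSq f ≤ C * CahnHilliard.linDissipation c f := by
  -- The constant involves only the first moment of the slope of the centred kink, hence neither the
  -- dimension nor c.
  refine ⟨CahnHilliard.dissipationConst,
    lt_of_lt_of_le one_pos CahnHilliard.one_le_dissipationConst, fun n c f hf h => ?_⟩
  exact hasSum_le (CahnHilliard.sum_modeEnergy_le hf h)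
    (CahnHilliard.hasSum_gradNormSq fun j => (hf.weakDeriv j).memLp)
    ((CahnHilliard.hasSum_gradNormSq fun j =>
      CahnHilliard.memLp_weakDeriv_linOp hf j).mul_left _)
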